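/- Let $R$ be an integral domain which is not a field and in which every principal ideal $(m)$ with $m \in R^\times := R\setminus\{0\}$ has finite index. Let $\mathfrak{A}[R]$ be the universal C*-algebra generated by isometries $s_m$ ($m \in R^\times$) and unitaries $u^n$ ($n \in R$) subject to the relations $$\text{(i)}\ s_k s_m = s_{km},\qquad \text{(ii)}\ u^l u^n = u^{l+n},\qquad \text{(iii)}\ s_m u^n = u^{mn} s_m,\qquad \text{(iv)}\ \sum_{n+(m)\in R/(m)} u^n s_m s_m^* u^{-n} = 1$$ for all $k,m\in R^\times$ and $l,n\in R$. Let $A$ be a nonzero unital C*-algebra which is generated, as a C*-algebra, by isometries $\{t_m : m\in R^\times\}$ and unitaries $\{v^n : n\in R\}$ satisfying the relations (i)--(iv), with $t_m$ and $v^n$ in place of $s_m$ and $u^n$. Then $A$ is canonically isomorphic to $\mathfrak{A}[R]$: there is a unique $*$-isomorphism $\mathfrak{A}[R]\to A$ with $s_m\mapsto t_m$ and $u^n\mapsto v^n$ for all $m\in R^\times$, $n\in R$. In particular, let $\mathfrak{A}_r[R]\subset\mathcal{L}(\ell^2(R))$ be the regular C*-algebra of $R$, that is, the C*-algebra generated by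 the operators $S_m$ ($m\in R^\times$) and $U^n$ ($n\in R$) given on the standard orthonormal basis $(\xi_r)_{r\in R}$ of $\ell^2(R)$ by $S_m\xi_r=\xi_{mr}$ and $U^n\xi_r=\xi_{n+r}$. Then there is a unique $*$-isomorphism $\mathfrak{A}[R]\to\mathfrak{A}_r[R]$ with $s_m\mapsto S_m$ and $u^n\mapsto U^n$ for all $m\in R^\times$, $n\in R$. -/

import Mathlib

open scoped nonZeroDivisors

universe u v

noncomputable section

namespace RingCStar

/-! ### The defining relations -/

/-- The defining relations for elements `s m` (`m ≠ 0`) and `u n` of a unital complex `*`-algebra,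
where "`x = y`" is read as `E x y`.
For elements of a C*-algebra, `E` is equality (so that the `s m` are isometries and the `u n` are
unitaries); for a C*-seminorm `p` on a `*`-algebra, `E x y` is `p (x - y) = 0`.
In `range_sum`, the sum runs over the cosets of `(m)`, each coset being represented by some element
of it; when `(m)` has finite index, this is a finite sum.  See `conj_range_eq` for the independence
of the representatives. -/
structure Relations {R : Type u} [CommRing R] {A : Type v} [Ring A] [StarRing A]
    (E : A → A → Prop) (s : R⁰ → A) (u : R → A) : Prop where
  isometry : ∀ m, E (star (s m) * s m) 1
  unitary_left : ∀ n, E (star (u n) * u n) 1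
  unitary_right : ∀ n, E (u n * star (u n)) 1
  s_mul_s : ∀ k m, E (s k * s m) (s (k * m))
  u_mul_u : ∀ l n, E (u l * u n) (u (l + n))
  s_mul_u : ∀ (m : R⁰) (n : R), E (s m * u n) (u ((m : R) * n) * s m)
  range_sum : ∀ m : R⁰,
    E (∑ᶠ c : R ⧸ Ideal.span {(m : R)}, u c.out * (s m * star (s m)) * u (-c.out)) 1

/-- The projection `u^n e_m u^{-n}` only depends on the coset `n + (m)`. -/
theorem conj_range_eq {R : Type u} [CommRing R] {A : Type v} [Ring A] [StarRing A]
    {s : R⁰ → A} {u : R → A} (h : Relations Eq s u) (m : R⁰) {n n' : R}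
    (hn : (Ideal.Quotient.mk (Ideal.span {(m : R)}) n) = Ideal.Quotient.mk _ n') :
    u n * (s m * star (s m)) * u (-n) = u n' * (s m * star (s m)) * u (-n') := by
  rw [Ideal.Quotient.eq, Ideal.mem_span_singleton] at hn
  obtain ⟨k, hk⟩ := hn
  obtain rfl : n = n' + m * k := by rw [← hk]; ring
  have h0 : u 0 = 1 := by
    have h1 := h.unitary_left 0
    have h2 := h.u_mul_u 0 0
    rw [add_zero] at h2
    calc u 0 = (star (u 0) * u 0) * u 0 := by rw [h1, one_mul]
      _ = 1 := by rw [mul_assoc, h2, h1]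
  have hst : ∀ x, u (-x) = star (u x) := fun x => by
    calc u (-x) = (star (u x) * u x) * u (-x) := by rw [h.unitary_left, one_mul]
      _ = star (u x) := by rw [mul_assoc, h.u_mul_u, add_neg_cancel, h0, mul_one]
  rw [hst, hst, ← h.u_mul_u n']
  calc u n' * u (m * k) * (s m * star (s m)) * star (u n' * u (m * k))
      = u n' * ((u (m * k) * s m) * star (u (m * k) * s m)) * star (u n') := by
        simp only [star_mul, mul_assoc]
    _ = u n' * (s m * (u k * star (u k)) * star (s m)) * star (u n') := by
        rw [← h.s_mul_u]; simp only [star_mul, mul_assoc]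
    _ = _ := by rw [h.unitary_right, mul_one]

/-! ### The free `*`-algebra on the generators -/

/-- The free unital complex `*`-algebra on symbols `s_m` (`m ≠ 0`) and `u^n` (`n ∈ R`): the
noncommutative polynomials in these symbols (`Sum.inl`) and their formal adjoints (`Sum.inr`). -/
def FreeStarAlg (R : Type u) [CommRing R] : Type u :=
  FreeAlgebra ℂ ((R⁰ ⊕ R) ⊕ (R⁰ ⊕ R))

section Free

variable (R : Type u) [CommRing R]

instance : Ring (FreeStarAlg R) :=
  inferInstanceAs (Ring (FreeAlgebra ℂ ((R⁰ ⊕ R) ⊕ (R⁰ ⊕ R))))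

instance : Algebra ℂ (FreeStarAlg R) :=
  inferInstanceAs (Algebra ℂ (FreeAlgebra ℂ ((R⁰ ⊕ R) ⊕ (R⁰ ⊕ R))))

variable {R}

namespace FreeStarAlg

/-- The letters of the free `*`-algebra. -/
def letter (x : (R⁰ ⊕ R) ⊕ (R⁰ ⊕ R)) : FreeStarAlg R := FreeAlgebra.ι ℂ x

/-- The generator `s_m`. -/
def s (m : R⁰) : FreeStarAlg R := letter (Sum.inl (Sum.inl m))

/-- The generator `u^n`. -/
def u (n : R) : FreeStarAlg R := letter (Sum.inl (Sum.inr n))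

/-- The conjugate-linear ring homomorphism to the opposite algebra that exchanges each symbol with
its formal adjoint. -/
def starHom : FreeStarAlg R →+* (FreeStarAlg R)ᵐᵒᵖ :=
  letI : Algebra ℂ (FreeStarAlg R)ᵐᵒᵖ :=
    RingHom.toAlgebra' ((algebraMap ℂ (FreeStarAlg R)ᵐᵒᵖ).comp (starRingEnd ℂ))
      (fun c x => Algebra.commutes (starRingEnd ℂ c) x)
  (FreeAlgebra.lift ℂ (fun x => MulOpposite.op (letter (R := R) x.swap))).toRingHom

theorem starHom_letter (x : (R⁰ ⊕ R) ⊕ (R⁰ ⊕ R)) :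
    starHom (letter x) = MulOpposite.op (letter x.swap) := by
  let _ : Algebra ℂ (FreeStarAlg R)ᵐᵒᵖ :=
    RingHom.toAlgebra' ((algebraMap ℂ (FreeStarAlg R)ᵐᵒᵖ).comp (starRingEnd ℂ))
      (fun c x => Algebra.commutes (starRingEnd ℂ c) x)
  exact FreeAlgebra.lift_ι_apply (R := ℂ)
    (fun x => MulOpposite.op (letter (R := R) x.swap)) x

theorem starHom_algebraMap (c : ℂ) :
    starHom (algebraMap ℂ (FreeStarAlg R) c) =
      MulOpposite.op (algebraMap ℂ (FreeStarAlg R) (starRingEnd ℂ c)) := by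
  let _ : Algebra ℂ (FreeStarAlg R)ᵐᵒᵖ :=
    RingHom.toAlgebra' ((algebraMap ℂ (FreeStarAlg R)ᵐᵒᵖ).comp (starRingEnd ℂ))
      (fun c x => Algebra.commutes (starRingEnd ℂ c) x)
  exact AlgHom.commutes (FreeAlgebra.lift ℂ
    (fun x : (R⁰ ⊕ R) ⊕ (R⁰ ⊕ R) => MulOpposite.op (letter (R := R) x.swap))) c

theorem induction {motive : FreeStarAlg R → Prop}
    (algebraMap : ∀ c : ℂ, motive (algebraMap ℂ (FreeStarAlg R) c))
    (letter : ∀ x, motive (letter x))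
    (mul : ∀ a b, motive a → motive b → motive (a * b))
    (add : ∀ a b, motive a → motive b → motive (a + b)) (a : FreeStarAlg R) : motive a :=
  FreeAlgebra.induction ℂ _ algebraMap letter mul add a

instance : StarRing (FreeStarAlg R) where
  star x := (starHom x).unop
  star_involutive x := by
    induction x using FreeStarAlg.induction with
    | algebraMap c => simp [starHom_algebraMap]
    | letter x => simp [starHom_letter]
    | mul a b ha hb => simp [ha, hb]
    | add a b ha hb => simp [ha, hb]
  star_mul a b := by simp
  star_add a b := by simp

theorem star_letter (x : (R⁰ ⊕ R) ⊕ (R⁰ ⊕ R)) : star (letter x) = letter x.swap := by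
  change (starHom (letter x)).unop = _
  rw [starHom_letter]; rfl

instance : StarModule ℂ (FreeStarAlg R) where
  star_smul c x := by
    change (starHom (c • x)).unop = star c • (starHom x).unop
    rw [Algebra.smul_def, map_mul, starHom_algebraMap, MulOpposite.unop_mul, MulOpposite.unop_op,
      ← Algebra.commutes, ← Algebra.smul_def]
    rfl

end FreeStarAlg

end Free

/-! ### The universal C*-algebra -/

/-- A C*-seminorm on the free `*`-algebra in which the defining relations hold. -/
structure CStarSeminorm (R : Type u) [CommRing R] extends Seminorm ℂ (FreeStarAlg R) where
  mul_le' : ∀ x y, toFun (x * y) ≤ toFun x * toFun y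
  star_mul_self' : ∀ x, toFun (star x * x) = toFun x ^ 2
  relations : Relations (fun x y => toFun (x - y) = 0) (FreeStarAlg.s (R := R)) FreeStarAlg.u

namespace CStarSeminorm

variable {R : Type u} [CommRing R]

instance : Inhabited (CStarSeminorm R) where
  default :=
    { toSeminorm := 0
      mul_le' := fun _ _ => (mul_zero (0 : ℝ)).ge
      star_mul_self' := fun _ => (zero_pow two_ne_zero).symm
      relations := by constructor <;> intros <;> rfl }

variable (p : CStarSeminorm R)

theorem mul_le (x y : FreeStarAlg R) :
    p.toSeminorm (x * y) ≤ p.toSeminorm x * p.toSeminorm y := p.mul_le' x y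

theorem star_mul_self (x : FreeStarAlg R) :
    p.toSeminorm (star x * x) = p.toSeminorm x ^ 2 := p.star_mul_self' x

theorem one_le : p.toSeminorm 1 ≤ 1 := by
  have h := p.star_mul_self 1
  rw [star_one, one_mul] at h
  nlinarith [apply_nonneg p.toSeminorm 1]

theorem le_star (x : FreeStarAlg R) : p.toSeminorm x ≤ p.toSeminorm (star x) := by
  have h := p.star_mul_self x
  have h2 := p.mul_le (star x) x
  rcases (apply_nonneg p.toSeminorm x).eq_or_lt with h0 | h0
  · rw [← h0]; exact apply_nonneg _ _
  · nlinarith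

theorem apply_star (x : FreeStarAlg R) : p.toSeminorm (star x) = p.toSeminorm x :=
  le_antisymm (by simpa using p.le_star (star x)) (p.le_star x)

theorem le_one_of_isometry {x : FreeStarAlg R} (h : p.toSeminorm (star x * x - 1) = 0) :
    p.toSeminorm x ≤ 1 := by
  have h1 : p.toSeminorm (star x * x) ≤ p.toSeminorm (star x * x - 1) + p.toSeminorm 1 := by
    simpa using map_add_le_add p.toSeminorm (star x * x - 1) 1
  have := p.one_le
  rw [p.star_mul_self] at h1
  nlinarith [apply_nonneg p.toSeminorm x]

theorem letter_le_one (x : (R⁰ ⊕ R) ⊕ (R⁰ ⊕ R)) : p.toSeminorm (FreeStarAlg.letter x) ≤ 1 := by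
  have key : ∀ y : R⁰ ⊕ R, p.toSeminorm (FreeStarAlg.letter (Sum.inl y)) ≤ 1 := by
    rintro (m | n)
    · exact p.le_one_of_isometry (p.relations.isometry m)
    · exact p.le_one_of_isometry (p.relations.unitary_left n)
  rcases x with y | y
  · exact key y
  · rw [← p.apply_star, FreeStarAlg.star_letter]
    exact key y

/-- The generators have norm at most one, so the C*-seminorms are bounded at each point. -/
theorem exists_bound (x : FreeStarAlg R) : ∃ C, ∀ p : CStarSeminorm R, p.toSeminorm x ≤ C := by
  induction x using FreeStarAlg.induction with
  | algebraMap c =>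
    refine ⟨‖c‖, fun p => ?_⟩
    rw [Algebra.algebraMap_eq_smul_one, map_smul_eq_mul]
    exact mul_le_of_le_one_right (norm_nonneg _) p.one_le
  | letter x => exact ⟨1, fun p => p.letter_le_one x⟩
  | mul a b ha hb =>
    obtain ⟨C, hC⟩ := ha
    obtain ⟨D, hD⟩ := hb
    exact ⟨C * D, fun p => (p.mul_le a b).trans (mul_le_mul (hC p) (hD p) (apply_nonneg _ _)
      ((apply_nonneg _ _).trans (hC p)))⟩
  | add a b ha hb =>
    obtain ⟨C, hC⟩ := ha
    obtain ⟨D, hD⟩ := hb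
    exact ⟨C + D, fun p => (map_add_le_add _ a b).trans (add_le_add (hC p) (hD p))⟩

theorem bddAbove (x : FreeStarAlg R) :
    BddAbove (Set.range fun p : CStarSeminorm R => p.toSeminorm x) := by
  obtain ⟨C, hC⟩ := exists_bound x
  exact ⟨C, by rintro _ ⟨p, rfl⟩; exact hC p⟩

theorem le_iSup (x : FreeStarAlg R) :
    p.toSeminorm x ≤ ⨆ q : CStarSeminorm R, q.toSeminorm x :=
  le_ciSup (bddAbove x) p

variable (R) in
/-- The largest C*-seminorm in which the defining relations hold. -/
def maximal : CStarSeminorm R where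
  toFun x := ⨆ p : CStarSeminorm R, p.toSeminorm x
  map_zero' := by simp
  add_le' x y := ciSup_le fun p =>
    (map_add_le_add _ x y).trans (add_le_add (p.le_iSup x) (p.le_iSup y))
  neg' x := by simp
  smul' c x := by
    simp only [map_smul_eq_mul]
    exact (Real.mul_iSup_of_nonneg (norm_nonneg c) _).symm
  mul_le' x y := ciSup_le fun p =>
    (p.mul_le x y).trans (mul_le_mul (p.le_iSup x) (p.le_iSup y) (apply_nonneg _ _)
      ((apply_nonneg _ _).trans (p.le_iSup x)))
  star_mul_self' x := by
    have h0 : 0 ≤ ⨆ p : CStarSeminorm R, p.toSeminorm x :=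
      (apply_nonneg _ _).trans ((default : CStarSeminorm R).le_iSup x)
    apply le_antisymm
    · refine ciSup_le fun p => ?_
      rw [p.star_mul_self]
      exact pow_le_pow_left₀ (apply_nonneg _ _) (p.le_iSup x) 2
    · have h1 : (⨆ p : CStarSeminorm R, p.toSeminorm x) ≤
          √(⨆ p : CStarSeminorm R, p.toSeminorm (star x * x)) := by
        refine ciSup_le fun p => Real.le_sqrt_of_sq_le ?_
        rw [← p.star_mul_self]
        exact p.le_iSup _
      calc _ ≤ (√(⨆ p : CStarSeminorm R, p.toSeminorm (star x * x))) ^ 2 :=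
            pow_le_pow_left₀ h0 h1 2
        _ = _ := Real.sq_sqrt ((apply_nonneg _ _).trans ((default : CStarSeminorm R).le_iSup _))
  relations := by
    have key : ∀ x : FreeStarAlg R, (∀ p : CStarSeminorm R, p.toSeminorm x = 0) →
        (⨆ p : CStarSeminorm R, p.toSeminorm x) = 0 := fun x h => by simp [h]
    constructor <;> intros <;> refine key _ fun p => ?_
    · exact p.relations.isometry _
    · exact p.relations.unitary_left _
    · exact p.relations.unitary_right _
    · exact p.relations.s_mul_s _ _
    · exact p.relations.u_mul_u _ _
    · exact p.relations.s_mul_u _ _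
    · exact p.relations.range_sum _

theorem le_maximal (x : FreeStarAlg R) :
    p.toSeminorm x ≤ (maximal R).toSeminorm x := p.le_iSup x

end CStarSeminorm

section Norm

variable (R : Type u) [CommRing R]

/-- The free `*`-algebra is normed by the largest C*-seminorm in which the relations hold. -/
instance : SeminormedRing (FreeStarAlg R) :=
  { (inferInstance : Ring (FreeStarAlg R)),
    (CStarSeminorm.maximal R).toSeminorm.toAddGroupSeminorm.toSeminormedAddCommGroup with
    norm_mul_le := (CStarSeminorm.maximal R).mul_le }

variable {R}

theorem FreeStarAlg.norm_def (x : FreeStarAlg R) :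
    ‖x‖ = (CStarSeminorm.maximal R).toSeminorm x := rfl

instance : NormedSpace ℂ (FreeStarAlg R) where
  norm_smul_le c x := (map_smul_eq_mul (CStarSeminorm.maximal R).toSeminorm c x).le

instance : NormedStarGroup (FreeStarAlg R) where
  norm_star_le x := ((CStarSeminorm.maximal R).apply_star x).le

end Norm

open UniformSpace

/-- The universal C*-algebra `𝔄[R]` generated by isometries `s_m`, `m ≠ 0`, and unitaries `u^n`,
`n ∈ R`, subject to the defining relations: the (Hausdorff) completion of the free `*`-algebra on
these symbols with respect to the largest C*-seminorm in which the relations hold. -/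
def UnivAlg (R : Type u) [CommRing R] : Type u := Completion (FreeStarAlg R)

namespace UnivAlg

variable (R : Type u) [CommRing R]

instance : NormedRing (UnivAlg R) := inferInstanceAs (NormedRing (Completion (FreeStarAlg R)))

instance : CompleteSpace (UnivAlg R) :=
  inferInstanceAs (CompleteSpace (Completion (FreeStarAlg R)))

instance : NormedAlgebra ℂ (UnivAlg R) :=
  { (inferInstanceAs (Algebra ℂ (Completion (FreeStarAlg R))) : Algebra ℂ (UnivAlg R)) with
    norm_smul_le := fun c x => norm_smul_le (β := Completion (FreeStarAlg R)) c x }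

/-- The canonical map from the free `*`-algebra, as a ring homomorphism. -/
def coe : FreeStarAlg R →+* UnivAlg R := Completion.coeRingHom

variable {R}

theorem norm_coe (x : FreeStarAlg R) : ‖coe R x‖ = ‖x‖ := Completion.norm_coe x

theorem coe_smul (c : ℂ) (x : FreeStarAlg R) : coe R (c • x) = c • coe R x :=
  Completion.coe_smul c x

theorem denseRange_coe : DenseRange (coe R) := Completion.denseRange_coe

theorem uniformContinuous_star : UniformContinuous (star : FreeStarAlg R → FreeStarAlg R) :=
  (starₗᵢ ℂ : FreeStarAlg R ≃ₗᵢ⋆[ℂ] FreeStarAlg R).isometry.uniformContinuous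

instance : Star (UnivAlg R) where
  star := Completion.map (star : FreeStarAlg R → FreeStarAlg R)

theorem continuous_star' : Continuous (star : UnivAlg R → UnivAlg R) :=
  Completion.continuous_map

theorem star_coe (x : FreeStarAlg R) : star (coe R x) = coe R (star x) :=
  Completion.map_coe uniformContinuous_star x

theorem induction_on {motive : UnivAlg R → Prop} (a : UnivAlg R)
    (hp : IsClosed {a | motive a}) (ih : ∀ x, motive (coe R x)) : motive a :=
  Completion.induction_on a hp ih

instance : StarRing (UnivAlg R) where
  star_involutive a := by
    induction a using induction_on with
    | hp => exact isClosed_eq (continuous_star'.comp continuous_star') continuous_id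
    | ih x => rw [star_coe, star_coe, star_star]
  star_mul a b := by
    induction a using induction_on with
    | hp =>
      exact isClosed_eq (continuous_star'.comp (continuous_id.mul continuous_const))
        (continuous_const.mul continuous_star')
    | ih x =>
      induction b using induction_on with
      | hp =>
        exact isClosed_eq (continuous_star'.comp (continuous_const.mul continuous_id))
          (continuous_star'.mul continuous_const)
      | ih y => rw [← map_mul, star_coe, star_coe, star_coe, star_mul, map_mul]
  star_add a b := by
    induction a using induction_on with
    | hp =>
      exact isClosed_eq (continuous_star'.comp (continuous_id.add continuous_const))
        (continuous_star'.add continuous_const)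
    | ih x =>
      induction b using induction_on with
      | hp =>
        exact isClosed_eq (continuous_star'.comp (continuous_const.add continuous_id))
          (continuous_const.add continuous_star')
      | ih y => rw [← map_add, star_coe, star_coe, star_coe, star_add, map_add]

instance : StarModule ℂ (UnivAlg R) where
  star_smul c a := by
    induction a using induction_on with
    | hp =>
      exact isClosed_eq (continuous_star'.comp (continuous_const_smul c))
        (continuous_star'.const_smul (star c))
    | ih x => rw [← coe_smul, star_coe, star_coe, star_smul, coe_smul]

instance : CStarRing (UnivAlg R) where
  norm_mul_self_le a := by
    induction a using induction_on with
    | hp =>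
      exact isClosed_le (continuous_norm.mul continuous_norm)
        ((continuous_star'.mul continuous_id).norm)
    | ih x =>
      rw [star_coe, ← map_mul, norm_coe, norm_coe, FreeStarAlg.norm_def, FreeStarAlg.norm_def,
        CStarSeminorm.star_mul_self, sq]

instance : CStarAlgebra (UnivAlg R) where

/-- The canonical isometry `s_m` of `𝔄[R]`. -/
def s (m : R⁰) : UnivAlg R := coe R (FreeStarAlg.s m)

/-- The canonical unitary `u^n` of `𝔄[R]`. -/
def u (n : R) : UnivAlg R := coe R (FreeStarAlg.u n)

/-- The generators of `𝔄[R]` satisfy the defining relations. -/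
theorem relations [hR : ∀ m : R⁰, Finite (R ⧸ Ideal.span {(m : R)})] :
    Relations Eq (s (R := R)) u := by
  have key : ∀ x y : FreeStarAlg R, (CStarSeminorm.maximal R).toSeminorm (x - y) = 0 →
      coe R x = coe R y := fun x y h => by
    rw [← sub_eq_zero, ← map_sub, ← norm_eq_zero, norm_coe, FreeStarAlg.norm_def, h]
  have h := (CStarSeminorm.maximal R).relations
  constructor
  · intro m
    simpa [s, star_coe] using key _ _ (h.isometry m)
  · intro n
    simpa [u, star_coe] using key _ _ (h.unitary_left n)
  · intro n
    simpa [u, star_coe] using key _ _ (h.unitary_right n)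
  · intro k m
    simpa [s] using key _ _ (h.s_mul_s k m)
  · intro l n
    simpa [u] using key _ _ (h.u_mul_u l n)
  · intro m n
    simpa [s, u] using key _ _ (h.s_mul_u m n)
  · intro m
    have h1 := key _ _ (h.range_sum m)
    have e := AddMonoidHom.map_finsum (coe R : FreeStarAlg R →+ UnivAlg R)
      (f := fun c : R ⧸ Ideal.span {(m : R)} => FreeStarAlg.u c.out *
        (FreeStarAlg.s m * star (FreeStarAlg.s m)) * FreeStarAlg.u (-c.out))
      (Set.toFinite _)
    simpa [s, u, star_coe] using e.symm.trans h1

/-- The universal property of `𝔄[R]`. -/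
theorem existsUnique_lift [hR : ∀ m : R⁰, Finite (R ⧸ Ideal.span {(m : R)})]
    {A : Type v} [CStarAlgebra A] {s' : R⁰ → A} {u' : R → A} (h : Relations Eq s' u') :
    ∃! φ : UnivAlg R →⋆ₐ[ℂ] A, (∀ m, φ (s m) = s' m) ∧ ∀ n, φ (u n) = u' n := by
  let g : (R⁰ ⊕ R) ⊕ (R⁰ ⊕ R) → A := Sum.elim (Sum.elim s' u') (star ∘ Sum.elim s' u')
  let f : FreeStarAlg R →ₐ[ℂ] A := FreeAlgebra.lift ℂ g
  have hf : ∀ x, f (FreeStarAlg.letter x) = g x := fun x => FreeAlgebra.lift_ι_apply g x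
  have hfs : ∀ m, f (FreeStarAlg.s m) = s' m := fun m => hf _
  have hfu : ∀ n, f (FreeStarAlg.u n) = u' n := fun n => hf _
  have hstar : ∀ x, f (star x) = star (f x) := fun x => by
    induction x using FreeStarAlg.induction with
    | algebraMap c =>
      rw [← algebraMap_star_comm, AlgHom.commutes, AlgHom.commutes, algebraMap_star_comm]
    | letter x =>
      rw [FreeStarAlg.star_letter, hf, hf]
      rcases x with x | x <;> simp [g]
    | mul a b ha hb => simp [ha, hb]
    | add a b ha hb => simp [ha, hb]
  let p : CStarSeminorm R :=
    { toSeminorm := (normSeminorm ℂ A).comp f.toLinearMap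
      mul_le' := fun x y => by
        change ‖f (x * y)‖ ≤ ‖f x‖ * ‖f y‖
        rw [map_mul]; exact norm_mul_le _ _
      star_mul_self' := fun x => by
        change ‖f (star x * x)‖ = ‖f x‖ ^ 2
        rw [map_mul, hstar, CStarRing.norm_star_mul_self, sq]
      relations := by
        have key : ∀ x y : FreeStarAlg R, f x = f y → ‖f (x - y)‖ = 0 := fun x y e => by
          rw [map_sub, e, sub_self, norm_zero]
        constructor
        · intro m
          exact key _ _ (by simpa [hstar, hfs] using h.isometry m)
        · intro n
          exact key _ _ (by simpa [hstar, hfu] using h.unitary_left n)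
        · intro n
          exact key _ _ (by simpa [hstar, hfu] using h.unitary_right n)
        · intro k m
          exact key _ _ (by simpa [hfs] using h.s_mul_s k m)
        · intro l n
          exact key _ _ (by simpa [hfu] using h.u_mul_u l n)
        · intro m n
          exact key _ _ (by simpa [hfs, hfu] using h.s_mul_u m n)
        · intro m
          refine key _ _ ?_
          have e := AddMonoidHom.map_finsum (f : FreeStarAlg R →+ A)
            (f := fun c : R ⧸ Ideal.span {(m : R)} => FreeStarAlg.u c.out *
              (FreeStarAlg.s m * star (FreeStarAlg.s m)) * FreeStarAlg.u (-c.out))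
            (Set.toFinite _)
          refine e.trans ?_
          simpa [hstar, hfs, hfu] using h.range_sum m }
  have hle : ∀ x, ‖f x‖ ≤ ‖x‖ := fun x => p.le_maximal x
  have hcont : Continuous f.toRingHom :=
    AddMonoidHomClass.continuous_of_bound f.toRingHom 1 (fun x => by simpa using! hle x)
  let F : UnivAlg R →+* A := Completion.extensionHom f.toRingHom hcont
  have hF : ∀ x, F (coe R x) = f x := fun x => Completion.extensionHom_coe f.toRingHom hcont x
  have hFc : Continuous F := Completion.continuous_extension
  let φ : UnivAlg R →⋆ₐ[ℂ] A :=
    { F with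
      commutes' := fun c => (hF (algebraMap ℂ _ c)).trans (f.commutes c)
      map_star' := fun a => by
        change F (star a) = star (F a)
        induction a using induction_on with
        | hp => exact isClosed_eq (hFc.comp continuous_star') hFc.star
        | ih x => rw [star_coe, hF, hF, hstar] }
  refine ⟨φ, ⟨fun m => (hF _).trans (hfs m), fun n => (hF _).trans (hfu n)⟩, ?_⟩
  rintro ψ ⟨h1, h2⟩
  have hψc : Continuous ψ :=
    AddMonoidHomClass.continuous_of_bound ψ 1 (fun x => by
      simpa using NonUnitalStarAlgHom.norm_apply_le ψ x)
  have hψ : ∀ x, ψ (coe R x) = f x := fun x => by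
    induction x using FreeStarAlg.induction with
    | algebraMap c => exact (ψ.toAlgHom.commutes c).trans (f.commutes c).symm
    | letter x =>
      have h3 : ∀ y, ψ (coe R (FreeStarAlg.letter (Sum.inl y))) =
          f (FreeStarAlg.letter (Sum.inl y)) := by
        rintro (m | n)
        · exact (h1 m).trans (hfs m).symm
        · exact (h2 n).trans (hfu n).symm
      rcases x with y | y
      · exact h3 y
      · have e : FreeStarAlg.letter (R := R) (Sum.inr y) =
            star (FreeStarAlg.letter (Sum.inl y)) := by rw [FreeStarAlg.star_letter]; rfl
        rw [e, ← star_coe, map_star, h3, hstar]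
    | mul a b ha hb => rw [map_mul, map_mul, map_mul, ha, hb]
    | add a b ha hb => rw [map_add, map_add, map_add, ha, hb]
  ext a
  induction a using induction_on with
  | hp => exact isClosed_eq hψc hFc
  | ih x => exact (hψ x).trans (hF x).symm

end UnivAlg

/-! ### The regular C*-algebra -/

section Regular

variable (R : Type u)

/-- The Hilbert space `ℓ²(R)`. -/
abbrev Ell2 : Type u := lp (fun _ : R => ℂ) 2

variable {R}

open Classical in
/-- The standard basis vector `ξ_r` of `ℓ²(R)`. -/
def xi (r : R) : Ell2 R := lp.single 2 r (1 : ℂ)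

theorem orthonormal_xi : Orthonormal ℂ (xi (R := R)) := by
  classical
  rw [orthonormal_iff_ite]
  intro i j
  simp only [xi, lp.inner_single_left, lp.single_apply, Pi.single_apply]
  split_ifs <;> simp_all

/-- The linear isometry of `ℓ²(R)` with `ξ_r ↦ ξ_{f r}`, for an injective map `f`. -/
def pushIsometry (f : R → R) (hf : Function.Injective f) : Ell2 R →ₗᵢ[ℂ] Ell2 R :=
  (orthonormal_xi.comp f hf).orthogonalFamily.linearIsometry

theorem pushIsometry_xi (f : R → R) (hf : Function.Injective f) (r : R) :
    pushIsometry f hf (xi r) = xi (f r) := by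
  classical
  have := (orthonormal_xi.comp f hf).orthogonalFamily.linearIsometry_apply_single
    (i := r) (1 : ℂ)
  simpa only [pushIsometry, xi, LinearIsometry.toSpanSingleton_apply, one_smul,
    Function.comp_apply] using this

variable [CommRing R]

/-- The operator `S_m` on `ℓ²(R)`, `S_m ξ_r = ξ_{mr}`. -/
def regS (m : R⁰) : Ell2 R →L[ℂ] Ell2 R :=
  (pushIsometry (fun r => (m : R) * r)
    (fun _ _ h => (mul_cancel_left_mem_nonZeroDivisors m.2).1 h)).toContinuousLinearMap

/-- The operator `U^n` on `ℓ²(R)`, `U^n ξ_r = ξ_{n+r}`. -/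
def regU (n : R) : Ell2 R →L[ℂ] Ell2 R :=
  (pushIsometry (fun r => n + r) (add_right_injective n)).toContinuousLinearMap

theorem regS_xi (m : R⁰) (r : R) : regS m (xi r) = xi ((m : R) * r) :=
  pushIsometry_xi (fun r => (m : R) * r)
    (fun _ _ h => (mul_cancel_left_mem_nonZeroDivisors m.2).1 h) r

theorem regU_xi (n r : R) : regU n (xi r) = xi (n + r) :=
  pushIsometry_xi (fun r => n + r) (add_right_injective n) r

variable (R) in
/-- The regular C*-algebra `𝔄_r[R]`: the C*-subalgebra of `L(ℓ²(R))` generated by all `S_m`, `U^n`.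
(It contains the identity, since `S_m` is an isometry.) -/
def regAlg : StarSubalgebra ℂ (Ell2 R →L[ℂ] Ell2 R) :=
  (StarAlgebra.adjoin ℂ (Set.range (regS (R := R)) ∪ Set.range regU)).topologicalClosure

theorem regS_mem (m : R⁰) : regS m ∈ regAlg R :=
  StarSubalgebra.le_topologicalClosure _
    (StarAlgebra.subset_adjoin ℂ _ (Or.inl ⟨m, rfl⟩))

theorem regU_mem (n : R) : regU n ∈ regAlg R :=
  StarSubalgebra.le_topologicalClosure _
    (StarAlgebra.subset_adjoin ℂ _ (Or.inr ⟨n, rfl⟩))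

end Regular

end RingCStar

end

/-!
The algebra `𝔄[R]` is spanned, up to closure, by the elements `s_k^* x s_m` with `x` in the core,
which is in turn spanned by the elements `1_{i + (N)} u^n`. The former have the degree `m / k` in
the group of fractions of `R⁰`; the latter, for fixed `N`, have the degree `n` in `R`. As `R` is not
a field, every element of nonzero degree is annihilated by the compression to a sufficiently small
coset, and no coset projection is killed by a `*`-homomorphism `π` to a nonzero algebra. Compressing
to such cosets shows that `‖π y‖` bounds the norms of the homogeneous components of `y`, up to a
constant. Both groups of degrees are commutative, so the number of components of `(y* y) ^ k` grows
only polynomially in `k`, and `k`-th roots give `‖y‖ ≤ ‖π y‖`. Hence every `π` on `𝔄[R]` is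
isometric. Neither a conditional expectation onto the core nor the independence of the components is
needed.
-/

noncomputable section

namespace RingCStar

section Grading

open Filter
open scoped Pointwise

theorem exists_sum_nsmul_of_mem_nsmul {ι : Type*} [AddCommMonoid ι] [DecidableEq ι]
    {F : Finset ι} {k : ℕ} {x : ι} (hx : x ∈ k • F) :
    ∃ f : ι → ℕ, (∀ i, f i ≤ k) ∧ ∑ i ∈ F, f i • i = x := by
  induction k generalizing x with
  | zero => exact ⟨0, fun _ => le_rfl, by simpa [eq_comm] using hx⟩
  | succ k ih =>
    rw [succ_nsmul, Finset.mem_add] at hx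
    obtain ⟨y, hy, j, hj, rfl⟩ := hx
    obtain ⟨f, hf, rfl⟩ := ih hy
    refine ⟨f + Pi.single j 1, fun i => add_le_add (hf i) ?_, ?_⟩
    · exact (Pi.single_mono j le_rfl : Pi.single j 1 ≤ Pi.single j 1) i |>.trans
        (by rw [Pi.single_apply]; split_ifs <;> simp)
    · simp [add_smul, Finset.sum_add_distrib, Pi.single_apply, hj]

theorem card_nsmul_le {ι : Type*} [AddCommMonoid ι] [DecidableEq ι] (F : Finset ι)
    (k : ℕ) : (k • F).card ≤ (k + 1) ^ F.card := by
  have hsub : k • F ⊆ (Fintype.piFinset fun _ : F => Finset.range (k + 1)).image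
      fun f : F → ℕ => ∑ i : F, f i • (i : ι) := by
    intro x hx
    obtain ⟨f, hf, rfl⟩ := exists_sum_nsmul_of_mem_nsmul hx
    refine Finset.mem_image.2 ⟨fun i => f i, ?_, Finset.sum_coe_sort F fun i => f i • i⟩
    simpa [Nat.lt_succ_iff] using fun i _ => hf i
  calc (k • F).card ≤ _ := Finset.card_le_card hsub
    _ ≤ _ := Finset.card_image_le
    _ = (k + 1) ^ F.card := by simp

theorem le_of_frequently_pow_le {a C M : ℝ} {d : ℕ} (hM : 0 ≤ M)
    (h : ∃ᶠ k : ℕ in atTop, a ^ k ≤ C * (k + 1) ^ d * M ^ k) : a ≤ M := by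
  by_contra! hlt
  have hlittle : (fun k : ℕ => C * (k + 1) ^ d * M ^ k) =o[atTop] fun k => a ^ k := by
    refine Asymptotics.IsBigO.trans_isLittleO (.of_bound (|C| * 2 ^ d) ?_)
      (isLittleO_pow_const_mul_const_pow_const_pow_of_norm_lt d
        (by rwa [Real.norm_of_nonneg hM] : ‖M‖ < a))
    filter_upwards [eventually_ge_atTop 1] with k hk
    have hk' : (1 : ℝ) ≤ k := by exact_mod_cast hk
    rw [Real.norm_eq_abs, Real.norm_of_nonneg (by positivity), abs_mul, abs_mul,
      abs_of_nonneg (by positivity : (0 : ℝ) ≤ (k + 1) ^ d),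
      abs_of_nonneg (by positivity : 0 ≤ M ^ k)]
    calc |C| * (k + 1) ^ d * M ^ k ≤ |C| * (2 * k) ^ d * M ^ k := by gcongr; linarith
      _ = |C| * 2 ^ d * (k ^ d * M ^ k) := by ring
  refine h ((hlittle.def one_half_pos).mono fun k hk => not_le.2 ?_)
  have hak : 0 < a ^ k := pow_pos (hM.trans_lt hlt) k
  rw [Real.norm_eq_abs, Real.norm_of_nonneg hak.le] at hk
  linarith [le_abs_self (C * (k + 1) ^ d * M ^ k)]

theorem exists_eq_sum_of_mem_iSup {ι S M : Type*} [Semiring S] [AddCommMonoid M] [Module S M]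
    {ℳ : ι → Submodule S M} {x : M} (hx : x ∈ ⨆ i, ℳ i) :
    ∃ (F : Finset ι) (z : ι → M), (∀ i, z i ∈ ℳ i) ∧ x = ∑ i ∈ F, z i := by
  obtain ⟨f, hf, hsum⟩ := (Submodule.mem_iSup_iff_exists_finsupp ℳ x).1 hx
  exact ⟨f.support, f, hf, hsum.symm⟩

theorem exists_sum_pow_eq_sum_nsmul {ι S B : Type*} [AddCommMonoid ι] [DecidableEq ι]
    [CommSemiring S] [Semiring B] [Algebra S B] {ℬ : ι → Submodule S B} [SetLike.GradedMonoid ℬ]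
    {z : ι → B} (hz : ∀ i, z i ∈ ℬ i) (F : Finset ι) (k : ℕ) :
    ∃ w : ι → B, (∀ i, w i ∈ ℬ i) ∧ (∑ i ∈ F, z i) ^ k = ∑ i ∈ k • F, w i := by
  induction k with
  | zero =>
    refine ⟨Pi.single 0 1, fun i => ?_, by simp⟩
    rcases eq_or_ne i 0 with rfl | hi
    · simpa using SetLike.GradedOne.one_mem
    · simp [hi]
  | succ k ih =>
    obtain ⟨w, hw, hpow⟩ := ih
    refine ⟨fun i => ∑ p ∈ (k • F) ×ˢ F with p.1 + p.2 = i, w p.1 * z p.2, fun i => ?_, ?_⟩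
    · refine Submodule.sum_mem _ fun p hp => ?_
      rw [← (Finset.mem_filter.1 hp).2]
      exact SetLike.mul_mem_graded (hw _) (hz _)
    · rw [pow_succ, hpow, Finset.sum_mul_sum, ← Finset.sum_product', succ_nsmul,
        Finset.sum_fiberwise_of_maps_to]
      exact fun p hp => Finset.add_mem_add (Finset.mem_product.1 hp).1 (Finset.mem_product.1 hp).2

theorem norm_pow_star_mul_self {B : Type*} [NormedRing B] [StarRing B] [CStarRing B] (y : B)
    (n : ℕ) : ‖(star y * y) ^ 2 ^ n‖ = (‖y‖ ^ 2) ^ 2 ^ n := by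
  rw [(IsSelfAdjoint.star_mul_self y).norm_pow_two_pow, CStarRing.norm_star_mul_self, pow_two]

/-- A commutative monoid grows polynomially, so `(y* y) ^ k` has only polynomially many components;
the polynomial factor disappears on taking `k`-th roots. -/
theorem norm_le_of_graded_pow_le {ι B : Type*} [AddCommMonoid ι] [NormedRing B] [StarRing B]
    [CStarRing B] [NormedAlgebra ℂ B] {ℬ : ι → Submodule ℂ B} [SetLike.GradedMonoid ℬ] {y : B}
    (hy : star y * y ∈ ⨆ i, ℬ i) {C M : ℝ} (hC : 0 ≤ C) (hM : 0 ≤ M)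
    (bound : ∀ (k : ℕ) (F : Finset ι) (z : ι → B), 0 < k → (∀ i, z i ∈ ℬ i) →
      (star y * y) ^ k = ∑ i ∈ F, z i → ∀ i ∈ F, ‖z i‖ ≤ C * M ^ (2 * k)) : ‖y‖ ≤ M := by
  classical
  obtain ⟨F, x, hx, hsum⟩ := exists_eq_sum_of_mem_iSup hy
  refine le_of_sq_le_sq ?_ hM
  refine le_of_frequently_pow_le (C := C) (d := F.card) (sq_nonneg M) ?_
  refine (tendsto_pow_atTop_atTop_of_one_lt one_lt_two).frequently (.of_forall fun n => ?_)
  obtain ⟨z, hz, hpow⟩ := exists_sum_pow_eq_sum_nsmul hx F (2 ^ n)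
  rw [← hsum] at hpow
  have hcard : ((2 ^ n • F).card : ℝ) ≤ ((2 ^ n : ℕ) + 1) ^ F.card := by
    exact_mod_cast card_nsmul_le F (2 ^ n)
  calc (‖y‖ ^ 2) ^ 2 ^ n = ‖∑ i ∈ 2 ^ n • F, z i‖ := by rw [← norm_pow_star_mul_self, hpow]
    _ ≤ (2 ^ n • F).card * (C * M ^ (2 * 2 ^ n)) := by
      rw [← nsmul_eq_mul]
      exact (norm_sum_le _ _).trans
        (Finset.sum_le_card_nsmul _ _ _ (bound _ _ z (by positivity) hz hpow))
    _ ≤ ((2 ^ n : ℕ) + 1) ^ F.card * (C * M ^ (2 * 2 ^ n)) := by gcongr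
    _ = C * ((2 ^ n : ℕ) + 1) ^ F.card * (M ^ 2) ^ 2 ^ n := by rw [← pow_mul]; ring

/-- A family of subspaces of a `*`-algebra that multiply and are permuted by `*` in the way the
homogeneous components of a grading are. The subspaces need be neither independent nor spanning: in
a C*-algebra that is only known through generators and relations, independence is a conclusion. -/
structure IsStarGrading {ι S B : Type*} [AddGroup ι] [CommSemiring S] [Semiring B] [StarRing B]
    [Algebra S B] (ℬ : ι → Submodule S B) : Prop extends SetLike.GradedMonoid ℬ where
  star_mem : ∀ {i x}, x ∈ ℬ i → star x ∈ ℬ (-i)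

namespace IsStarGrading

variable {ι S B : Type*} [AddGroup ι] [CommSemiring S] [Semiring B] [StarRing B] [Algebra S B]
  {ℬ : ι → Submodule S B}

theorem mul_mem_zero (hℬ : IsStarGrading ℬ) {x y : B} (hx : x ∈ ℬ 0) (hy : y ∈ ℬ 0) :
    x * y ∈ ℬ 0 := by
  simpa only [add_zero] using hℬ.mul_mem hx hy

theorem star_mem_zero (hℬ : IsStarGrading ℬ) {x : B} (hx : x ∈ ℬ 0) : star x ∈ ℬ 0 := by
  simpa only [neg_zero] using hℬ.star_mem hx

theorem pow_mem_zero (hℬ : IsStarGrading ℬ) {x : B} (hx : x ∈ ℬ 0) (k : ℕ) : x ^ k ∈ ℬ 0 := by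
  have := hℬ.toGradedMonoid
  simpa only [nsmul_zero] using SetLike.pow_mem_graded k hx

theorem mul_mem_iSup (hℬ : IsStarGrading ℬ) {x y : B} (hx : x ∈ ⨆ i, ℬ i) (hy : y ∈ ⨆ i, ℬ i) :
    x * y ∈ ⨆ i, ℬ i := by
  have hle : (⨆ i, ℬ i) * (⨆ i, ℬ i) ≤ ⨆ i, ℬ i := by
    simp only [Submodule.iSup_mul, Submodule.mul_iSup, iSup_le_iff, Submodule.mul_le]
    exact fun i j x hx y hy => Submodule.mem_iSup_of_mem (j + i) (hℬ.mul_mem hx hy)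
  exact hle (Submodule.mul_mem_mul hx hy)

theorem star_mem_iSup (hℬ : IsStarGrading ℬ) {x : B} (hx : x ∈ ⨆ i, ℬ i) :
    star x ∈ ⨆ i, ℬ i := by
  obtain ⟨F, z, hz, rfl⟩ := exists_eq_sum_of_mem_iSup hx
  rw [star_sum]
  exact Submodule.sum_mem _ fun i _ => Submodule.mem_iSup_of_mem (-i) (hℬ.star_mem (hz i))

/-- The `*`-algebra of finite sums of homogeneous elements. -/
def starSubalgebra [StarRing S] [StarModule S B] (hℬ : IsStarGrading ℬ) : StarSubalgebra S B where
  __ := (⨆ i, ℬ i).toSubalgebra (Submodule.mem_iSup_of_mem 0 hℬ.one_mem)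
    fun _ _ => hℬ.mul_mem_iSup
  star_mem' := hℬ.star_mem_iSup

theorem mul_mem_iSup_ne_zero (hℬ : IsStarGrading ℬ) {x w : B} (hx : x ∈ ℬ 0)
    (hw : w ∈ ⨆ (i) (_ : i ≠ 0), ℬ i) : x * w ∈ ⨆ (i) (_ : i ≠ 0), ℬ i := by
  suffices (⨆ (i) (_ : i ≠ 0), ℬ i) ≤
      (⨆ (i) (_ : i ≠ 0), ℬ i).comap (LinearMap.mulLeft S x) from this hw
  exact iSup₂_le fun i hi w hw =>
    Submodule.mem_iSup_of_mem i <| Submodule.mem_iSup_of_mem hi (zero_add i ▸ hℬ.mul_mem hx hw)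

theorem iSup_ne_zero_mul_mem (hℬ : IsStarGrading ℬ) {x w : B} (hx : x ∈ ℬ 0)
    (hw : w ∈ ⨆ (i) (_ : i ≠ 0), ℬ i) : w * x ∈ ⨆ (i) (_ : i ≠ 0), ℬ i := by
  suffices (⨆ (i) (_ : i ≠ 0), ℬ i) ≤
      (⨆ (i) (_ : i ≠ 0), ℬ i).comap (LinearMap.mulRight S x) from this hw
  exact iSup₂_le fun i hi w hw =>
    Submodule.mem_iSup_of_mem i <| Submodule.mem_iSup_of_mem hi (add_zero i ▸ hℬ.mul_mem hw hx)

theorem star_mem_iSup_ne_zero (hℬ : IsStarGrading ℬ) {w : B}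
    (hw : w ∈ ⨆ (i) (_ : i ≠ 0), ℬ i) : star w ∈ ⨆ (i) (_ : i ≠ 0), ℬ i := by
  induction hw using Submodule.iSup_induction' with
  | mem i w hw =>
    by_cases hi : i = 0
    · obtain rfl : w = 0 := by simpa [hi] using hw
      simp
    · rw [iSup_pos hi] at hw
      exact Submodule.mem_iSup_of_mem (-i) <|
        Submodule.mem_iSup_of_mem (neg_ne_zero.2 hi) (hℬ.star_mem hw)
  | zero => simp
  | add x y _ _ hx hy => rw [star_add]; exact add_mem hx hy

end IsStarGrading

/-- The degree-zero component of `star (z i) * ∑ j ∈ F, z j` is `star (z i) * z i`, whose norm is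
`‖z i‖ ^ 2`. -/
theorem IsStarGrading.norm_component_le {ι A B : Type*} [AddGroup ι] [CStarAlgebra B]
    [CStarAlgebra A] {ℬ : ι → Submodule ℂ B} (hℬ : IsStarGrading ℬ) (π : B →⋆ₐ[ℂ] A)
    (hπ : ∀ x ∈ ℬ 0, ∀ w ∈ ⨆ (i) (_ : i ≠ 0), ℬ i, ‖x‖ ≤ ‖π (x + w)‖) {z : ι → B}
    (hz : ∀ i, z i ∈ ℬ i) {F : Finset ι} {i : ι} (hi : i ∈ F) : ‖z i‖ ≤ ‖π (∑ j ∈ F, z j)‖ := by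
  classical
  have hsplit : star (z i) * ∑ j ∈ F, z j =
      star (z i) * z i + ∑ j ∈ F.erase i, star (z i) * z j := by
    rw [Finset.mul_sum, Finset.add_sum_erase _ (fun j => star (z i) * z j) hi]
  have hzero : star (z i) * z i ∈ ℬ 0 := by
    simpa using hℬ.mul_mem (hℬ.star_mem (hz i)) (hz i)
  have hoff : ∑ j ∈ F.erase i, star (z i) * z j ∈ ⨆ (j) (_ : j ≠ 0), ℬ j :=
    Submodule.sum_mem _ fun j hj => Submodule.mem_iSup_of_mem (-i + j) <|
      Submodule.mem_iSup_of_mem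
        (by simpa [neg_add_eq_zero, eq_comm] using Finset.ne_of_mem_erase hj)
        (hℬ.mul_mem (hℬ.star_mem (hz i)) (hz j))
  have hsq : ‖z i‖ * ‖z i‖ ≤ ‖z i‖ * ‖π (∑ j ∈ F, z j)‖ :=
    calc ‖z i‖ * ‖z i‖ = ‖star (z i) * z i‖ := CStarRing.norm_star_mul_self.symm
      _ ≤ ‖π (star (z i) * ∑ j ∈ F, z j)‖ := by rw [hsplit]; exact hπ _ hzero _ hoff
      _ ≤ ‖π (star (z i))‖ * ‖π (∑ j ∈ F, z j)‖ := by rw [map_mul]; exact norm_mul_le _ _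
      _ ≤ ‖z i‖ * ‖π (∑ j ∈ F, z j)‖ := by
        gcongr
        simpa using NonUnitalStarAlgHom.norm_apply_le π (star (z i))
  rcases (norm_nonneg (z i)).eq_or_lt with h0 | hpos
  · rw [← h0]; exact norm_nonneg _
  · exact le_of_mul_le_mul_left hsq hpos

theorem IsStarGrading.norm_le_norm_map {ι A B : Type*} [AddCommGroup ι] [CStarAlgebra B]
    [CStarAlgebra A] {ℬ : ι → Submodule ℂ B} (hℬ : IsStarGrading ℬ) (π : B →⋆ₐ[ℂ] A)
    (hπ : ∀ x ∈ ℬ 0, ∀ w ∈ ⨆ (i) (_ : i ≠ 0), ℬ i, ‖x‖ ≤ ‖π (x + w)‖) {y : B}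
    (hy : y ∈ ⨆ i, ℬ i) : ‖y‖ ≤ ‖π y‖ := by
  have := hℬ.toGradedMonoid
  refine norm_le_of_graded_pow_le (hℬ.mul_mem_iSup (hℬ.star_mem_iSup hy) hy) zero_le_one
    (norm_nonneg _) fun k F z hk hz hpow i hi => ?_
  calc ‖z i‖ ≤ ‖π (∑ j ∈ F, z j)‖ := hℬ.norm_component_le π hπ hz hi
    _ = ‖(star (π y) * π y) ^ k‖ := by rw [← hpow, map_pow, map_mul, map_star]
    _ ≤ ‖star (π y) * π y‖ ^ k := norm_pow_le' _ hk
    _ = 1 * ‖π y‖ ^ (2 * k) := by rw [CStarRing.norm_star_mul_self, one_mul, pow_mul, pow_two]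

end Grading

section CStar

variable {A : Type*} [CStarAlgebra A]

theorem norm_le_norm_add_of_star_mul_eq_zero {x w : A} (h : star x * w = 0) :
    ‖x‖ ≤ ‖x + w‖ := by
  let _ := CStarAlgebra.spectralOrder A
  have _ := CStarAlgebra.spectralOrderedRing A
  have h' : star w * x = 0 := by simpa using congrArg star h
  have hsum : star (x + w) * (x + w) = star x * x + star w * w := by
    rw [star_add, add_mul, mul_add, mul_add, h, h', add_zero, zero_add]
  have hle : ‖star x * x‖ ≤ ‖star (x + w) * (x + w)‖ :=
    CStarAlgebra.norm_le_norm_of_nonneg_of_le (star_mul_self_nonneg x)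
      (by rw [hsum]; exact le_add_of_nonneg_right (star_mul_self_nonneg w))
  rw [CStarRing.norm_star_mul_self, CStarRing.norm_star_mul_self] at hle
  exact abs_le_of_sq_le_sq' (by simpa only [pow_two] using hle) (norm_nonneg _) |>.2

theorem norm_pow_mul_le_of_star_mul_eq_zero {x w v : A} {k : ℕ}
    (h : ∀ j < k, star (x * ((star x * x) ^ j * v)) * (w * ((star x * x) ^ j * v)) = 0)
    (h' : ∀ j < k, star (star x * (x * ((star x * x) ^ j * v))) *
      (star w * (x * ((star x * x) ^ j * v))) = 0) :
    ‖(star x * x) ^ k * v‖ ≤ ‖x + w‖ ^ (2 * k) * ‖v‖ := by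
  induction k with
  | zero => simp
  | succ k ih =>
    set y := (star x * x) ^ k * v with hy
    have hxy : ‖x * y‖ ≤ ‖x + w‖ * ‖y‖ :=
      calc ‖x * y‖ ≤ ‖x * y + w * y‖ := norm_le_norm_add_of_star_mul_eq_zero (h k k.lt_succ_self)
        _ ≤ ‖x + w‖ * ‖y‖ := by rw [← add_mul]; exact norm_mul_le _ _
    have hxxy : ‖star x * (x * y)‖ ≤ ‖x + w‖ * ‖x * y‖ :=
      calc ‖star x * (x * y)‖ ≤ ‖star x * (x * y) + star w * (x * y)‖ :=
            norm_le_norm_add_of_star_mul_eq_zero (h' k k.lt_succ_self)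
        _ ≤ ‖x + w‖ * ‖x * y‖ := by
          rw [← add_mul, ← star_add, ← norm_star (x + w)]; exact norm_mul_le _ _
    calc ‖(star x * x) ^ (k + 1) * v‖ = ‖star x * (x * y)‖ := by
          rw [hy, pow_succ']; simp only [mul_assoc]
      _ ≤ ‖x + w‖ * (‖x + w‖ * ‖y‖) := hxxy.trans (by gcongr)
      _ ≤ ‖x + w‖ * (‖x + w‖ * (‖x + w‖ ^ (2 * k) * ‖v‖)) := by
        gcongr
        exact ih (fun j hj => h j (hj.trans k.lt_succ_self))
          (fun j hj => h' j (hj.trans k.lt_succ_self))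
      _ = ‖x + w‖ ^ (2 * (k + 1)) * ‖v‖ := by ring

theorem mul_eq_zero_of_sum_isStarProjection {ι : Type*} [Fintype ι] {p : ι → A}
    (hp : ∀ i, IsStarProjection (p i)) (hsum : ∑ i, p i = 1) {i j : ι} (hij : i ≠ j) :
    p i * p j = 0 := by
  classical
  let _ := CStarAlgebra.spectralOrder A
  have _ := CStarAlgebra.spectralOrderedRing A
  have hle : p i ≤ 1 - p j := by
    rw [← hsum, ← Finset.sum_erase_eq_sub (Finset.mem_univ j)]
    exact Finset.single_le_sum (fun l _ => (hp l).nonneg)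
      (Finset.mem_erase.2 ⟨hij, Finset.mem_univ i⟩)
  have hmul : p i * (1 - p j) = p i := ((hp i).le_iff_mul_eq_left (hp j).one_sub).1 hle
  rwa [mul_sub, mul_one, sub_eq_self] at hmul

end CStar

section CosetProjections

variable {R : Type*} [CommRing R] {A : Type*} [Ring A] [StarRing A] {s : R⁰ → A} {u : R → A}

/-- The projection `1_{i + (N)} = u^i s_N s_N^* u^{-i}`. In the regular representation it is the
multiplication by the indicator function of the coset `i + (N)`. -/
def cosetProj (s : R⁰ → A) (u : R → A) (i : R) (N : R⁰) : A :=
  u i * (s N * star (s N)) * u (-i)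

namespace Relations

theorem u_zero (h : Relations Eq s u) : u 0 = 1 :=
  calc u 0 = star (u 0) * u 0 * u 0 := by rw [h.unitary_left, one_mul]
    _ = 1 := by rw [mul_assoc, h.u_mul_u, add_zero, h.unitary_left]

theorem u_mul_u_neg (h : Relations Eq s u) (n : R) : u n * u (-n) = 1 := by
  rw [h.u_mul_u, add_neg_cancel, h.u_zero]

theorem u_neg_mul_u (h : Relations Eq s u) (n : R) : u (-n) * u n = 1 := by
  rw [h.u_mul_u, neg_add_cancel, h.u_zero]

theorem star_u (h : Relations Eq s u) (n : R) : star (u n) = u (-n) :=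
  left_inv_eq_right_inv (h.unitary_left n) (h.u_mul_u_neg n)

theorem s_comm (h : Relations Eq s u) (k m : R⁰) : s k * s m = s m * s k := by
  rw [h.s_mul_s, h.s_mul_s, mul_comm]

theorem s_one (h : Relations Eq s u) : s 1 = 1 :=
  calc s 1 = star (s 1) * s 1 * s 1 := by rw [h.isometry, one_mul]
    _ = 1 := by rw [mul_assoc, h.s_mul_s, mul_one, h.isometry]

theorem star_s_mul_u (h : Relations Eq s u) (m : R⁰) (n : R) :
    star (s m) * u (m * n) = u n * star (s m) := by
  simpa [h.star_u] using (congrArg star (h.s_mul_u m (-n))).symm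

theorem star_s_mul_mul_s_eq (h : Relations Eq s u) (k m a : R⁰) (x : A) :
    star (s k) * x * s m = star (s (k * a)) * (s a * x * star (s a)) * s (m * a) := by
  rw [← h.s_mul_s, h.s_comm k, ← h.s_mul_s, h.s_comm m, star_mul]
  calc star (s k) * x * s m = star (s k) * (star (s a) * s a) * x * (star (s a) * s a) * s m := by
        rw [h.isometry, mul_one, mul_one]
    _ = _ := by simp only [mul_assoc]

theorem star_s_mul_mul_s_add (h : Relations Eq s u) {k m k' m' : R⁰} (hkm : m * k' = m' * k)
    (x x' : A) :
    star (s k) * x * s m + star (s k') * x' * s m' =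
      star (s (k * k')) * (s k' * x * star (s k') + s k * x' * star (s k)) * s (m * k') := by
  rw [h.star_s_mul_mul_s_eq k m k', h.star_s_mul_mul_s_eq k' m' k, mul_comm k' k, ← hkm,
    mul_add, add_mul]

theorem s_mul_star_s (h : Relations Eq s u) (m k : R⁰) :
    s m * star (s k) = star (s k) * s m * (s k * star (s k)) :=
  calc s m * star (s k) = star (s k) * s k * (s m * star (s k)) := by rw [h.isometry, one_mul]
    _ = star (s k) * (s k * s m) * star (s k) := by simp only [mul_assoc]
    _ = star (s k) * s m * (s k * star (s k)) := by rw [h.s_comm]; simp only [mul_assoc]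

theorem star_s_mul_mul_s_mul_star_s_mul_mul_s (h : Relations Eq s u) (k m k' m' : R⁰)
    (x x' : A) :
    star (s k) * x * s m * (star (s k') * x' * s m') =
      star (s (k * k')) * (s k' * x * star (s k') *
        (s m * (s k' * star (s k') * x') * star (s m))) * s (m * m') := by
  rw [← h.s_mul_s m, ← h.s_mul_s k, h.s_comm k, star_mul]
  calc star (s k) * x * s m * (star (s k') * x' * s m')
      = star (s k) * x * (s m * star (s k')) * x' * s m' := by simp only [mul_assoc]
    _ = star (s k) * (star (s k') * s k') * x * (star (s k') * s m * (s k' * star (s k'))) *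
          x' * (star (s m) * s m) * s m' := by
        rw [h.isometry, h.isometry, ← h.s_mul_star_s, mul_one, mul_one]
    _ = _ := by simp only [mul_assoc]

theorem cosetProj_zero (h : Relations Eq s u) (N : R⁰) :
    cosetProj s u 0 N = s N * star (s N) := by
  simp [cosetProj, h.u_zero]

theorem cosetProj_eq (h : Relations Eq s u) (i : R) (N : R⁰) :
    cosetProj s u i N = u i * s N * star (u i * s N) := by
  simp only [cosetProj, star_mul, h.star_u, mul_assoc]

theorem isStarProjection_cosetProj (h : Relations Eq s u) (i : R) (N : R⁰) :
    IsStarProjection (cosetProj s u i N) where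
  isIdempotentElem := by
    have hisom : star (u i * s N) * (u i * s N) = 1 := by
      rw [star_mul, mul_assoc, ← mul_assoc (star (u i)), h.unitary_left, one_mul, h.isometry]
    rw [IsIdempotentElem, h.cosetProj_eq, mul_assoc, ← mul_assoc (star _), hisom, one_mul]
  isSelfAdjoint := by rw [h.cosetProj_eq]; exact .mul_star_self _

theorem star_cosetProj (h : Relations Eq s u) (i : R) (N : R⁰) :
    star (cosetProj s u i N) = cosetProj s u i N :=
  (h.isStarProjection_cosetProj i N).isSelfAdjoint

theorem cosetProj_mul_self (h : Relations Eq s u) (i : R) (N : R⁰) :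
    cosetProj s u i N * cosetProj s u i N = cosetProj s u i N :=
  (h.isStarProjection_cosetProj i N).isIdempotentElem

theorem u_mul_cosetProj (h : Relations Eq s u) (n i : R) (N : R⁰) :
    u n * cosetProj s u i N = cosetProj s u (n + i) N * u n := by
  simp only [cosetProj, ← mul_assoc, h.u_mul_u]
  rw [mul_assoc _ (u (-(n + i))), h.u_mul_u, neg_add_rev, neg_add_cancel_right]

theorem s_mul_cosetProj (h : Relations Eq s u) (m : R⁰) (i : R) (N : R⁰) :
    s m * cosetProj s u i N = cosetProj s u (m * i) (m * N) * s m :=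
  calc s m * (u i * (s N * star (s N)) * u (-i))
      = s m * u i * (s N * (star (s N) * (star (s m) * s m))) * u (-i) := by
        rw [h.isometry, mul_one]; simp only [mul_assoc]
    _ = u (m * i) * (s m * s N * star (s m * s N)) * (s m * u (-i)) := by
        rw [h.s_mul_u, star_mul]; simp only [mul_assoc]
    _ = cosetProj s u (m * i) (m * N) * s m := by
        rw [h.s_mul_s, h.s_mul_u, mul_neg, cosetProj]; simp only [mul_assoc]

theorem cosetProj_mul_star_s (h : Relations Eq s u) (m : R⁰) (i : R) (N : R⁰) :
    cosetProj s u i N * star (s m) = star (s m) * cosetProj s u (m * i) (m * N) := by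
  simpa [h.star_cosetProj] using congrArg star (h.s_mul_cosetProj m i N)

theorem cosetProj_congr (h : Relations Eq s u) {i j : R} {N : R⁰} (hij : (N : R) ∣ i - j) :
    cosetProj s u i N = cosetProj s u j N :=
  conj_range_eq h N (by rwa [Ideal.Quotient.eq, Ideal.mem_span_singleton])

theorem cosetProj_mul_cosetProj_of_dvd (h : Relations Eq s u) {a c : R} {N q : R⁰} (hq : N ∣ q)
    (ha : (N : R) ∣ a - c) : cosetProj s u a q * cosetProj s u c N = cosetProj s u a q := by
  obtain ⟨M, rfl⟩ := hq
  have hrange : s (N * M) * star (s (N * M)) * (s N * star (s N)) =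
      s (N * M) * star (s (N * M)) :=
    calc s (N * M) * star (s (N * M)) * (s N * star (s N))
        = s (N * M) * star (s M) * (star (s N) * s N) * star (s N) := by
          rw [← h.s_mul_s, star_mul]; simp only [mul_assoc]
      _ = s (N * M) * star (s (N * M)) := by
          rw [h.isometry, mul_one, mul_assoc, ← star_mul, h.s_mul_s]
  rw [← h.cosetProj_congr ha]
  calc u a * (s (N * M) * star (s (N * M))) * u (-a) * (u a * (s N * star (s N)) * u (-a))
      = u a * (s (N * M) * star (s (N * M)) * (u (-a) * u a) * (s N * star (s N))) * u (-a) := by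
        simp only [mul_assoc]
    _ = cosetProj s u a (N * M) := by rw [h.u_neg_mul_u, mul_one, hrange, cosetProj]

theorem cosetProj_mul_cosetProj_of_dvd' (h : Relations Eq s u) {a c : R} {N q : R⁰} (hq : N ∣ q)
    (ha : (N : R) ∣ a - c) : cosetProj s u c N * cosetProj s u a q = cosetProj s u a q := by
  simpa [h.star_cosetProj] using congrArg star (h.cosetProj_mul_cosetProj_of_dvd hq ha)

theorem star_s_mul_cosetProj_mul_s (h : Relations Eq s u) (k : R⁰) (i : R) (N : R⁰) :
    star (s k) * cosetProj s u (k * i) (k * N) * s k = cosetProj s u i N := by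
  rw [mul_assoc, ← h.s_mul_cosetProj, ← mul_assoc, h.isometry, one_mul]

theorem sum_cosetProj (h : Relations Eq s u) (N : R⁰) [Fintype (R ⧸ Ideal.span {(N : R)})] :
    ∑ c : R ⧸ Ideal.span {(N : R)}, cosetProj s u c.out N = 1 := by
  rw [← h.range_sum N, finsum_eq_sum_of_fintype]; rfl

theorem cosetProj_eq_sum (h : Relations Eq s u) (i : R) (N M : R⁰)
    [Fintype (R ⧸ Ideal.span {(M : R)})] :
    cosetProj s u i N = ∑ c : R ⧸ Ideal.span {(M : R)}, cosetProj s u (i + N * c.out) (N * M) := by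
  have hconj (c : R) : u i * s N * cosetProj s u c M * star (u i * s N) =
      cosetProj s u (i + N * c) (N * M) := by
    rw [mul_assoc (u i), h.s_mul_cosetProj, ← mul_assoc, h.u_mul_cosetProj, mul_assoc, mul_assoc,
      ← mul_assoc (u i), ← h.cosetProj_eq]
    exact h.cosetProj_mul_cosetProj_of_dvd (dvd_mul_right N M) ⟨c, by ring⟩
  rw [← Finset.sum_congr rfl fun c _ => hconj c.out, ← Finset.sum_mul, ← Finset.mul_sum,
    h.sum_cosetProj, mul_one, h.cosetProj_eq]

end Relations

end CosetProjections

section CosetProjectionsCStar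

variable {R : Type*} [CommRing R] {A : Type*} [CStarAlgebra A] {s : R⁰ → A} {u : R → A}

namespace Relations

theorem cosetProj_mul_cosetProj_eq_zero (h : Relations Eq s u) {i j : R} {N : R⁰}
    [Finite (R ⧸ Ideal.span {(N : R)})] (hij : ¬ (N : R) ∣ i - j) :
    cosetProj s u i N * cosetProj s u j N = 0 := by
  have := Fintype.ofFinite (R ⧸ Ideal.span {(N : R)})
  have hout (i : R) : cosetProj s u i N =
      cosetProj s u (Ideal.Quotient.mk (Ideal.span {(N : R)}) i).out N :=
    conj_range_eq h N (Quotient.out_eq' (Ideal.Quotient.mk (Ideal.span {(N : R)}) i)).symm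
  rw [hout i, hout j]
  refine mul_eq_zero_of_sum_isStarProjection
    (p := fun c : R ⧸ Ideal.span {(N : R)} => cosetProj s u c.out N)
    (fun c => h.isStarProjection_cosetProj _ _) (h.sum_cosetProj N) fun hmk => hij ?_
  rwa [Ideal.Quotient.eq, Ideal.mem_span_singleton] at hmk

theorem cosetProj_mul_u_mul_cosetProj_eq_zero (h : Relations Eq s u) {i j n : R} {N : R⁰}
    [Finite (R ⧸ Ideal.span {(N : R)})] (hij : ¬ (N : R) ∣ i - (n + j)) :
    cosetProj s u i N * u n * cosetProj s u j N = 0 := by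
  rw [mul_assoc, h.u_mul_cosetProj, ← mul_assoc, h.cosetProj_mul_cosetProj_eq_zero hij, zero_mul]

variable [∀ m : R⁰, Finite (R ⧸ Ideal.span {(m : R)})]

theorem commute_cosetProj (h : Relations Eq s u) (i j : R) (N M : R⁰) :
    Commute (cosetProj s u i N) (cosetProj s u j M) := by
  have hsame (i j : R) : Commute (cosetProj s u i (N * M)) (cosetProj s u j (N * M)) := by
    by_cases hij : ((N * M : R⁰) : R) ∣ i - j
    · rw [h.cosetProj_congr hij]
    · rw [Commute, SemiconjBy, h.cosetProj_mul_cosetProj_eq_zero hij,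
        h.cosetProj_mul_cosetProj_eq_zero (by rwa [dvd_sub_comm])]
  have := Fintype.ofFinite (R ⧸ Ideal.span {(N : R)})
  have := Fintype.ofFinite (R ⧸ Ideal.span {(M : R)})
  rw [h.cosetProj_eq_sum i N M, h.cosetProj_eq_sum j M N, mul_comm M N]
  exact Commute.sum_left _ _ _ fun c _ => Commute.sum_right _ _ _ fun d _ => hsame _ _

end Relations

end CosetProjectionsCStar

section Core

variable {R : Type*} [CommRing R] {A : Type*} [CStarAlgebra A] {s : R⁰ → A} {u : R → A}

/-- The span of the elements `1_{i + (N)} u^n`, with `N` and `n` fixed: the component of degree `n`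
of the `N`-th level of the core. -/
def coreGrade (s : R⁰ → A) (u : R → A) (N : R⁰) (n : R) : Submodule ℂ A :=
  Submodule.span ℂ (Set.range fun i : R => cosetProj s u i N * u n)

theorem cosetProj_mul_u_mem_coreGrade (i n : R) (N : R⁰) :
    cosetProj s u i N * u n ∈ coreGrade s u N n :=
  Submodule.subset_span ⟨i, rfl⟩

namespace Relations

theorem u_mem_coreGrade (h : Relations Eq s u) (N : R⁰) [Finite (R ⧸ Ideal.span {(N : R)})]
    (n : R) : u n ∈ coreGrade s u N n := by
  have := Fintype.ofFinite (R ⧸ Ideal.span {(N : R)})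
  rw [← one_mul (u n), ← h.sum_cosetProj N, Finset.sum_mul]
  exact Submodule.sum_mem _ fun c _ => cosetProj_mul_u_mem_coreGrade _ _ _

theorem exists_cosetProj_mul_eq_smul (h : Relations Eq s u) {N : R⁰}
    [Finite (R ⧸ Ideal.span {(N : R)})] {n : R} {x : A} (hx : x ∈ coreGrade s u N n) (c : R) :
    ∃ l : ℂ, cosetProj s u c N * x = l • (cosetProj s u c N * u n) := by
  suffices coreGrade s u N n ≤ (ℂ ∙ (cosetProj s u c N * u n)).comap
      (LinearMap.mulLeft ℂ (cosetProj s u c N)) by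
    obtain ⟨l, hl⟩ := Submodule.mem_span_singleton.1 (this hx)
    exact ⟨l, hl.symm⟩
  refine Submodule.span_le.2 ?_
  rintro _ ⟨i, rfl⟩
  rw [SetLike.mem_coe, Submodule.mem_comap, LinearMap.mulLeft_apply, ← mul_assoc]
  by_cases hc : (N : R) ∣ c - i
  · rw [← h.cosetProj_congr hc, h.cosetProj_mul_self]
    exact Submodule.mem_span_singleton_self _
  · rw [h.cosetProj_mul_cosetProj_eq_zero hc, zero_mul]
    exact zero_mem _

theorem mul_mem_coreGrade (h : Relations Eq s u) {N : R⁰} [Finite (R ⧸ Ideal.span {(N : R)})]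
    {n n' : R} {x y : A} (hx : x ∈ coreGrade s u N n) (hy : y ∈ coreGrade s u N n') :
    x * y ∈ coreGrade s u N (n + n') := by
  suffices coreGrade s u N n * coreGrade s u N n' ≤ coreGrade s u N (n + n') from
    this (Submodule.mul_mem_mul hx hy)
  rw [coreGrade, coreGrade, Submodule.span_mul_span, Submodule.span_le]
  rintro _ ⟨_, ⟨i, rfl⟩, _, ⟨j, rfl⟩, rfl⟩
  have hmul : cosetProj s u i N * u n * (cosetProj s u j N * u n') =
      cosetProj s u i N * (cosetProj s u (n + j) N * u (n + n')) := by
    rw [mul_assoc, ← mul_assoc (u n), h.u_mul_cosetProj, mul_assoc _ (u n), h.u_mul_u]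
  obtain ⟨l, hl⟩ :=
    h.exists_cosetProj_mul_eq_smul (cosetProj_mul_u_mem_coreGrade (n + j) (n + n') N) i
  simp only [hmul, hl]
  exact Submodule.smul_mem _ l (cosetProj_mul_u_mem_coreGrade _ _ _)

theorem star_mem_coreGrade (h : Relations Eq s u) {N : R⁰} {n : R} {x : A}
    (hx : x ∈ coreGrade s u N n) : star x ∈ coreGrade s u N (-n) := by
  induction hx using Submodule.span_induction with
  | mem x hx =>
    obtain ⟨i, rfl⟩ := hx
    simp only [star_mul, h.star_u, h.star_cosetProj, h.u_mul_cosetProj]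
    exact cosetProj_mul_u_mem_coreGrade _ _ _
  | zero => simp
  | add x y _ _ hx hy => rw [star_add]; exact add_mem hx hy
  | smul c x _ hx => rw [star_smul]; exact Submodule.smul_mem _ _ hx

theorem isStarGrading_coreGrade (h : Relations Eq s u) (N : R⁰)
    [Finite (R ⧸ Ideal.span {(N : R)})] : IsStarGrading (coreGrade s u N) where
  one_mem := h.u_zero ▸ h.u_mem_coreGrade N 0
  mul_mem _ _ _ _ := h.mul_mem_coreGrade
  star_mem := h.star_mem_coreGrade

variable [∀ m : R⁰, Finite (R ⧸ Ideal.span {(m : R)})]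

/-- The level `N` of the core: the `*`-algebra spanned by the elements `1_{i + (N)} u^n`. -/
def coreLevel (h : Relations Eq s u) (N : R⁰) : StarSubalgebra ℂ A :=
  (h.isStarGrading_coreGrade N).starSubalgebra

theorem mem_coreLevel (h : Relations Eq s u) {N : R⁰} {x : A} :
    x ∈ h.coreLevel N ↔ x ∈ ⨆ n, coreGrade s u N n :=
  Iff.rfl

theorem cosetProj_mul_u_mem_coreLevel (h : Relations Eq s u) (i n : R) (N : R⁰) :
    cosetProj s u i N * u n ∈ h.coreLevel N :=
  Submodule.mem_iSup_of_mem n (cosetProj_mul_u_mem_coreGrade i n N)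

theorem coreLevel_le (h : Relations Eq s u) {N : R⁰} {P : Submodule ℂ A}
    (hP : ∀ i n, cosetProj s u i N * u n ∈ P) : (h.coreLevel N).toSubalgebra.toSubmodule ≤ P :=
  iSup_le fun n => Submodule.span_le.2 (Set.range_subset_iff.2 fun i => hP i n)

theorem coreLevel_mono (h : Relations Eq s u) {N M : R⁰} (hNM : N ∣ M) :
    h.coreLevel N ≤ h.coreLevel M := by
  obtain ⟨K, rfl⟩ := hNM
  have := Fintype.ofFinite (R ⧸ Ideal.span {(K : R)})
  refine h.coreLevel_le (P := (h.coreLevel (N * K)).toSubalgebra.toSubmodule) fun i n => ?_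
  rw [h.cosetProj_eq_sum i N K, Finset.sum_mul]
  exact Submodule.sum_mem _ fun c _ => h.cosetProj_mul_u_mem_coreLevel _ _ _

theorem directed_coreLevel (h : Relations Eq s u) : Directed (· ≤ ·) h.coreLevel := fun N M =>
  ⟨N * M, h.coreLevel_mono (dvd_mul_right N M), h.coreLevel_mono (dvd_mul_left M N)⟩

/-- The `*`-algebra spanned by all the elements `1_{i + (N)} u^n`. It is the component of degree `0`
of the grading `homog`. -/
def core (h : Relations Eq s u) : StarSubalgebra ℂ A :=
  ⨆ N, h.coreLevel N

theorem mem_core (h : Relations Eq s u) {x : A} : x ∈ h.core ↔ ∃ N, x ∈ h.coreLevel N := by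
  rw [← SetLike.mem_coe, core, StarSubalgebra.coe_iSup_of_directed h.directed_coreLevel]
  simp only [Set.mem_iUnion, SetLike.mem_coe]

theorem core_le (h : Relations Eq s u) {P : Submodule ℂ A}
    (hP : ∀ i N n, cosetProj s u i N * u n ∈ P) : h.core.toSubalgebra.toSubmodule ≤ P := by
  intro x hx
  obtain ⟨N, hxN⟩ := h.mem_core.1 hx
  exact h.coreLevel_le (fun i n => hP i N n) hxN

theorem cosetProj_mul_u_mem_core (h : Relations Eq s u) (i n : R) (N : R⁰) :
    cosetProj s u i N * u n ∈ h.core :=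
  h.mem_core.2 ⟨N, h.cosetProj_mul_u_mem_coreLevel i n N⟩

theorem cosetProj_mem_core (h : Relations Eq s u) (i : R) (N : R⁰) :
    cosetProj s u i N ∈ h.core := by
  simpa [h.u_zero] using h.cosetProj_mul_u_mem_core i 0 N

theorem u_mem_core (h : Relations Eq s u) (n : R) : u n ∈ h.core :=
  h.mem_core.2 ⟨1, Submodule.mem_iSup_of_mem n (h.u_mem_coreGrade 1 n)⟩

theorem s_mul_star_s_mem_core (h : Relations Eq s u) (N : R⁰) : s N * star (s N) ∈ h.core :=
  h.cosetProj_zero N ▸ h.cosetProj_mem_core 0 N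

theorem s_mul_mul_star_s_mem_core (h : Relations Eq s u) (k : R⁰) {x : A} (hx : x ∈ h.core) :
    s k * x * star (s k) ∈ h.core := by
  suffices h.core.toSubalgebra.toSubmodule ≤
      h.core.toSubalgebra.toSubmodule.comap (LinearMap.mulLeftRight ℂ (s k, star (s k))) from
    this hx
  refine h.core_le fun i N n => ?_
  have hmul : s k * (cosetProj s u i N * u n) * star (s k) =
      cosetProj s u (k * i) (k * N) * (u (k * n) * (s k * star (s k))) := by
    rw [← mul_assoc, h.s_mul_cosetProj, mul_assoc _ (s k), h.s_mul_u]
    simp only [mul_assoc]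
  rw [Submodule.mem_comap, LinearMap.mulLeftRight_apply, hmul]
  exact (mul_mem (h.cosetProj_mem_core _ _)
    (mul_mem (h.u_mem_core _) (h.s_mul_star_s_mem_core k)) : _ ∈ h.core)

theorem star_s_mul_cosetProj_mul_s_mem_core (h : Relations Eq s u) (k : R⁰) (i : R) (N : R⁰) :
    star (s k) * cosetProj s u i N * s k ∈ h.core := by
  have := Fintype.ofFinite (R ⧸ Ideal.span {(k : R)})
  rw [h.cosetProj_eq_sum i N k, Finset.mul_sum, Finset.sum_mul, mul_comm N k]
  refine sum_mem fun c _ => ?_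
  generalize i + N * c.out = j
  by_cases hj : (k : R) ∣ j
  · obtain ⟨l, rfl⟩ := hj
    rw [h.star_s_mul_cosetProj_mul_s]
    exact h.cosetProj_mem_core l N
  · have hzero : cosetProj s u j (k * N) * s k = 0 :=
      calc cosetProj s u j (k * N) * s k
          = cosetProj s u j (k * N) * (cosetProj s u j k * cosetProj s u 0 k) * s k := by
            rw [← mul_assoc, h.cosetProj_mul_cosetProj_of_dvd (dvd_mul_right k N) (by simp),
              h.cosetProj_zero, mul_assoc, mul_assoc, h.isometry, mul_one]
        _ = 0 := by
            rw [h.cosetProj_mul_cosetProj_eq_zero (by simpa using hj), mul_zero, zero_mul]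
    rw [mul_assoc, hzero, mul_zero]
    exact zero_mem _

theorem star_s_mul_u_mul_s_mem_core (h : Relations Eq s u) (k : R⁰) (n : R) :
    star (s k) * u n * s k ∈ h.core := by
  by_cases hn : (k : R) ∣ n
  · obtain ⟨l, rfl⟩ := hn
    rw [h.star_s_mul_u, mul_assoc, h.isometry, mul_one]
    exact h.u_mem_core l
  · have hzero : star (s k) * u n * s k = 0 :=
      calc star (s k) * u n * s k
          = star (s k) * s k * star (s k) * u n * (s k * (star (s k) * s k)) := by
            rw [h.isometry, one_mul, mul_one]
        _ = star (s k) * (cosetProj s u 0 k * u n * cosetProj s u 0 k) * s k := by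
            rw [h.cosetProj_zero]; simp only [mul_assoc]
        _ = 0 := by
            rw [h.cosetProj_mul_u_mul_cosetProj_eq_zero (by simpa using hn), mul_zero, zero_mul]
    rw [hzero]
    exact zero_mem _

theorem star_s_mul_mul_s_mem_core (h : Relations Eq s u) (k : R⁰) {x : A} (hx : x ∈ h.core) :
    star (s k) * x * s k ∈ h.core := by
  suffices h.core.toSubalgebra.toSubmodule ≤
      h.core.toSubalgebra.toSubmodule.comap (LinearMap.mulLeftRight ℂ (star (s k), s k)) from
    this hx
  refine h.core_le fun i N n => ?_
  have hmul : star (s k) * (cosetProj s u i N * u n) * s k =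
      star (s k) * cosetProj s u i N * s k * (star (s k) * u n * s k) :=
    calc star (s k) * (cosetProj s u i N * u n) * s k
        = star (s k) * s k * star (s k) * cosetProj s u i N * u n * s k := by
          rw [h.isometry, one_mul]; simp only [mul_assoc]
      _ = star (s k) * (cosetProj s u 0 k * cosetProj s u i N) * u n * s k := by
          rw [h.cosetProj_zero]; simp only [mul_assoc]
      _ = _ := by
          rw [(h.commute_cosetProj 0 i k N).eq, h.cosetProj_zero]; simp only [mul_assoc]
  rw [Submodule.mem_comap, LinearMap.mulLeftRight_apply, hmul]
  exact (mul_mem (h.star_s_mul_cosetProj_mul_s_mem_core k i N)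
    (h.star_s_mul_u_mul_s_mem_core k n) : _ ∈ h.core)

end Relations

end Core

section Negligible

variable {R : Type*} [CommRing R] {A : Type*} [CStarAlgebra A] {s : R⁰ → A} {u : R → A}

namespace Relations

theorem cosetProj_mul_mul_cosetProj_eq_zero_of_dvd (h : Relations Eq s u) {a a' : R} {q q' : R⁰}
    {w : A} (hw : cosetProj s u a q * w * cosetProj s u a q = 0) (hq : q ∣ q')
    (ha : (q : R) ∣ a' - a) : cosetProj s u a' q' * w * cosetProj s u a' q' = 0 :=
  calc cosetProj s u a' q' * w * cosetProj s u a' q'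
      = cosetProj s u a' q' * cosetProj s u a q * w *
          (cosetProj s u a q * cosetProj s u a' q') := by
        rw [h.cosetProj_mul_cosetProj_of_dvd hq ha, h.cosetProj_mul_cosetProj_of_dvd' hq ha]
    _ = cosetProj s u a' q' * (cosetProj s u a q * w * cosetProj s u a q) *
          cosetProj s u a' q' := by simp only [mul_assoc]
    _ = 0 := by rw [hw, mul_zero, zero_mul]

/-- The elements that can be compressed to `0` by the projection onto some coset inside any given
coset. In the main estimate they are the terms that can be discarded. -/
def negligible (h : Relations Eq s u) : Submodule ℂ A where
  carrier := {w | ∀ (c : R) (N : R⁰), ∃ (a : R) (q : R⁰), (N : R) ∣ a - c ∧ N ∣ q ∧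
    cosetProj s u a q * w * cosetProj s u a q = 0}
  zero_mem' c N := ⟨c, N, by simp, dvd_rfl, by simp⟩
  add_mem' {w w'} hw hw' c N := by
    obtain ⟨a, q, ha, hq, hz⟩ := hw c N
    obtain ⟨a', q', ha', hq', hz'⟩ := hw' a q
    have hNq : (N : R) ∣ q := map_dvd R⁰.subtype hq
    refine ⟨a', q', by simpa using (hNq.trans ha').add ha, hq.trans hq', ?_⟩
    rw [mul_add, add_mul, hz', add_zero]
    exact h.cosetProj_mul_mul_cosetProj_eq_zero_of_dvd hz hq' ha'
  smul_mem' l w hw c N := by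
    obtain ⟨a, q, ha, hq, hz⟩ := hw c N
    exact ⟨a, q, ha, hq, by rw [mul_smul_comm, smul_mul_assoc, hz, smul_zero]⟩

theorem exists_forall_cosetProj_mul_mul_cosetProj_eq_zero (h : Relations Eq s u) {T : Set A}
    (hT : T.Finite) (hTn : T ⊆ h.negligible) (c : R) (N : R⁰) :
    ∃ (a : R) (q : R⁰), (N : R) ∣ a - c ∧ N ∣ q ∧
      ∀ w ∈ T, cosetProj s u a q * w * cosetProj s u a q = 0 := by
  induction T, hT using Set.Finite.induction_on with
  | empty => exact ⟨c, N, by simp, dvd_rfl, by simp⟩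
  | @insert w T _ _ ih =>
    rw [Set.insert_subset_iff] at hTn
    obtain ⟨a, q, ha, hq, hz⟩ := ih hTn.2
    obtain ⟨a', q', ha', hq', hz'⟩ := hTn.1 a q
    have hNq : (N : R) ∣ q := map_dvd R⁰.subtype hq
    refine ⟨a', q', by simpa using (hNq.trans ha').add ha, hq.trans hq', ?_⟩
    rintro w (rfl | hw)
    · exact hz'
    · exact h.cosetProj_mul_mul_cosetProj_eq_zero_of_dvd (hz w hw) hq' ha'

variable [∀ m : R⁰, Finite (R ⧸ Ideal.span {(m : R)})]

/-- `s_k^* 1_{i + (N)} u^n s_m` maps functions supported on `a + (q)` to functions supported on the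
image of this coset under `b ↦ (n + m b) / k`. -/
theorem cosetProj_mul_monomial_mul_cosetProj_eq_zero (h : Relations Eq s u) {k m q : R⁰} {n a : R}
    (hq : ¬ (q : R) ∣ k * a - (n + m * a)) (i : R) (N : R⁰) :
    cosetProj s u a q * (star (s k) * (cosetProj s u i N * u n) * s m) * cosetProj s u a q = 0 :=
  calc cosetProj s u a q * (star (s k) * (cosetProj s u i N * u n) * s m) * cosetProj s u a q
      = cosetProj s u a q * star (s k) * cosetProj s u i N * u n * (s m * cosetProj s u a q) := by
        simp only [mul_assoc]
    _ = star (s k) * (cosetProj s u (k * a) (k * q) * cosetProj s u i N) * u n *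
          (cosetProj s u (m * a) (m * q) * s m) := by
        rw [h.cosetProj_mul_star_s, h.s_mul_cosetProj]; simp only [mul_assoc]
    _ = star (s k) * (cosetProj s u i N * (cosetProj s u (k * a) (k * q) *
          cosetProj s u (k * a) q)) * u n *
          (cosetProj s u (m * a) q * cosetProj s u (m * a) (m * q) * s m) := by
        rw [(h.commute_cosetProj (k * a) i (k * q) N).eq,
          h.cosetProj_mul_cosetProj_of_dvd (dvd_mul_left q k) (by simp),
          h.cosetProj_mul_cosetProj_of_dvd' (dvd_mul_left q m) (by simp)]
    _ = star (s k) * cosetProj s u i N * cosetProj s u (k * a) (k * q) *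
          (cosetProj s u (k * a) q * u n * cosetProj s u (m * a) q) *
          (cosetProj s u (m * a) (m * q) * s m) := by simp only [mul_assoc]
    _ = 0 := by
        rw [h.cosetProj_mul_u_mul_cosetProj_eq_zero hq, mul_zero, zero_mul]

theorem monomial_mem_negligible [IsDomain R] (hR : ¬ IsField R) (h : Relations Eq s u)
    {k m : R⁰} {n : R} (hkmn : k ≠ m ∨ n ≠ 0) (i : R) (N : R⁰) :
    star (s k) * (cosetProj s u i N * u n) * s m ∈ h.negligible := by
  intro c M
  obtain ⟨r, hr, hr'⟩ := Ring.exists_not_isUnit_of_not_isField hR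
  obtain ⟨a, ha, hfa⟩ : ∃ a : R, (M : R) ∣ a - c ∧ (k : R) * a - (n + m * a) ≠ 0 := by
    by_cases hc : (k : R) * c - (n + m * c) = 0
    · refine ⟨c + M, by simp, fun hcM => ?_⟩
      have hkm : ((k : R) - m) * M = 0 := by linear_combination hcM - hc
      obtain rfl : k = m := Subtype.ext <| sub_eq_zero.1 <|
        (mul_eq_zero.1 hkm).resolve_right (nonZeroDivisors.coe_ne_zero M)
      exact hkmn.elim (fun hne => hne rfl) fun hn => hn (by linear_combination -hc)
    · exact ⟨c, by simp, hc⟩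
  set f := (k : R) * a - (n + m * a) with hf
  refine ⟨a, M * ⟨r * f, mem_nonZeroDivisors_of_ne_zero (mul_ne_zero hr hfa)⟩, ha,
    dvd_mul_right _ _, h.cosetProj_mul_monomial_mul_cosetProj_eq_zero ?_ i N⟩
  rw [← hf]
  rintro ⟨d, hd⟩
  refine hr' (IsUnit.of_mul_eq_one (M * d) (mul_left_cancel₀ hfa ?_))
  rw [Submonoid.coe_mul] at hd
  linear_combination -hd

theorem u_mem_negligible [IsDomain R] (hR : ¬ IsField R) (h : Relations Eq s u) {n : R}
    (hn : n ≠ 0) : u n ∈ h.negligible := by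
  simpa [h.s_one, h.cosetProj_zero] using
    h.monomial_mem_negligible hR (k := 1) (m := 1) (.inr hn) 0 1

theorem star_s_mul_mul_s_mem_negligible [IsDomain R] (hR : ¬ IsField R) (h : Relations Eq s u)
    {k m : R⁰} (hkm : k ≠ m) {x : A} (hx : x ∈ h.core) :
    star (s k) * x * s m ∈ h.negligible := by
  suffices h.core.toSubalgebra.toSubmodule ≤
      h.negligible.comap (LinearMap.mulLeftRight ℂ (star (s k), s m)) from this hx
  exact h.core_le fun i N n => h.monomial_mem_negligible hR (.inl hkm) i N

end Relations

end Negligible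

section Homog

open Algebra (GrothendieckGroup)
open Algebra.GrothendieckGroup (of of_injective)

variable {R : Type*} [CommRing R] [IsDomain R]

instance isCancelMul_nonZeroDivisors : IsCancelMul R⁰ :=
  CommMagma.IsLeftCancelMul.toIsCancelMul _

variable {A : Type*} [CStarAlgebra A] {s : R⁰ → A} {u : R → A}
  [∀ m : R⁰, Finite (R ⧸ Ideal.span {(m : R)})]

namespace Relations

/-- The elements `s_k^* x s_m`, with `x` in the core, of degree `g = m / k` in the group of
fractions of `R⁰` (written additively, as gradings are). -/
def homog (h : Relations Eq s u) (g : Additive (GrothendieckGroup R⁰)) : Submodule ℂ A where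
  carrier := {y | ∃ k m : R⁰, of m = g.toMul * of k ∧ ∃ x ∈ h.core, y = star (s k) * x * s m}
  zero_mem' := by
    obtain ⟨⟨m, k⟩, hg⟩ := (Localization.monoidOf (⊤ : Submonoid R⁰)).surj g.toMul
    exact ⟨k, m, hg.symm, 0, zero_mem _, by simp⟩
  add_mem' := by
    rintro _ _ ⟨k, m, hkm, x, hx, rfl⟩ ⟨k', m', hkm', x', hx', rfl⟩
    refine ⟨k * k', m * k', by rw [map_mul, map_mul, hkm, mul_assoc], _,
      add_mem (h.s_mul_mul_star_s_mem_core k' hx) (h.s_mul_mul_star_s_mem_core k hx'),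
      h.star_s_mul_mul_s_add (of_injective ?_) x x'⟩
    rw [map_mul, map_mul, hkm, hkm', mul_right_comm]
  smul_mem' := by
    rintro l _ ⟨k, m, hkm, x, hx, rfl⟩
    exact ⟨k, m, hkm, l • x, h.core.toSubalgebra.smul_mem hx l, by
      rw [mul_smul_comm, smul_mul_assoc]⟩

theorem mul_mem_homog (h : Relations Eq s u) {g g' : Additive (GrothendieckGroup R⁰)} {y y' : A}
    (hy : y ∈ h.homog g) (hy' : y' ∈ h.homog g') : y * y' ∈ h.homog (g + g') := by
  obtain ⟨k, m, hkm, x, hx, rfl⟩ := hy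
  obtain ⟨k', m', hkm', x', hx', rfl⟩ := hy'
  refine ⟨k * k', m * m', ?_, _, ?_, h.star_s_mul_mul_s_mul_star_s_mul_mul_s k m k' m' x x'⟩
  · rw [map_mul, map_mul, hkm, hkm', toMul_add, mul_mul_mul_comm]
  · exact mul_mem (h.s_mul_mul_star_s_mem_core k' hx)
      (h.s_mul_mul_star_s_mem_core m (mul_mem (h.s_mul_star_s_mem_core k') hx'))

theorem star_mem_homog (h : Relations Eq s u) {g : Additive (GrothendieckGroup R⁰)} {y : A}
    (hy : y ∈ h.homog g) : star y ∈ h.homog (-g) := by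
  obtain ⟨k, m, hkm, x, hx, rfl⟩ := hy
  refine ⟨m, k, ?_, star x, star_mem hx, by simp [mul_assoc]⟩
  rw [hkm, toMul_neg, inv_mul_cancel_left]

theorem mem_homog_zero_of_mem_core (h : Relations Eq s u) {x : A} (hx : x ∈ h.core) :
    x ∈ h.homog 0 :=
  ⟨1, 1, by simp, x, hx, by simp [h.s_one]⟩

theorem mem_core_of_mem_homog_zero (h : Relations Eq s u) {x : A} (hx : x ∈ h.homog 0) :
    x ∈ h.core := by
  obtain ⟨k, m, hkm, x, hx, rfl⟩ := hx
  obtain rfl : m = k := of_injective (by simpa using hkm)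
  exact h.star_s_mul_mul_s_mem_core m hx

theorem isStarGrading_homog (h : Relations Eq s u) : IsStarGrading h.homog where
  one_mem := h.mem_homog_zero_of_mem_core (one_mem _)
  mul_mem _ _ _ _ := h.mul_mem_homog
  star_mem := h.star_mem_homog

theorem s_mem_homog (h : Relations Eq s u) (m : R⁰) : s m ∈ h.homog (.ofMul (of m)) :=
  ⟨1, m, by simp, 1, one_mem _, by simp [h.s_one]⟩

theorem homog_le_negligible (hR : ¬ IsField R) (h : Relations Eq s u)
    {g : Additive (GrothendieckGroup R⁰)} (hg : g ≠ 0) : h.homog g ≤ h.negligible := by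
  rintro _ ⟨k, m, hkm, x, hx, rfl⟩
  refine h.star_s_mul_mul_s_mem_negligible hR (fun hne => hg ?_) hx
  simpa [hne] using hkm

end Relations

end Homog

section Estimate

variable {R : Type*} [CommRing R] {B : Type*} [CStarAlgebra B] {A : Type*} [CStarAlgebra A]
  {s : R⁰ → B} {u : R → B}

namespace Relations

theorem one_le_norm_map_cosetProj [Nontrivial A] (h : Relations Eq s u) (π : B →⋆ₐ[ℂ] A) (i : R)
    (N : R⁰) : 1 ≤ ‖π (cosetProj s u i N)‖ := by
  have hone : star (s N) * u (-i) * cosetProj s u i N * (u i * s N) = 1 :=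
    calc star (s N) * u (-i) * cosetProj s u i N * (u i * s N)
        = star (s N) * (u (-i) * u i) * (s N * star (s N)) * (u (-i) * u i) * s N := by
          simp only [cosetProj, mul_assoc]
      _ = star (s N) * s N * (star (s N) * s N) := by
          rw [h.u_neg_mul_u]; simp only [mul_one, mul_assoc]
      _ = 1 := by rw [h.isometry, one_mul]
  have hpos : 0 < ‖π (cosetProj s u i N)‖ := by
    refine norm_pos_iff.2 fun h0 => one_ne_zero (α := A) ?_
    rw [← map_one π, ← hone, map_mul, map_mul, h0, mul_zero, zero_mul]
  refine le_of_mul_le_mul_right ?_ hpos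
  rw [one_mul]
  nth_rewrite 1 [← h.cosetProj_mul_self, map_mul]
  exact norm_mul_le _ _

theorem norm_u_le_one (h : Relations Eq s u) (n : R) : ‖u n‖ ≤ 1 := by
  rcases subsingleton_or_nontrivial B with _ | _
  · simp [Subsingleton.elim (u n) 0]
  · exact (CStarRing.norm_of_mem_unitary ⟨h.unitary_left n, h.unitary_right n⟩).le

theorem cosetProj_mul_u_neg_mul_mul_cosetProj (h : Relations Eq s u) {a c i j : R} {N q : R⁰}
    (hq : N ∣ q) (ha : (N : R) ∣ a - (-i + c)) {z : B} {l : ℂ}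
    (hz : cosetProj s u c N * z = l • (cosetProj s u c N * u j)) :
    cosetProj s u a q * (u (-i) * z) * cosetProj s u a q =
      l • (cosetProj s u a q * u (-i + j) * cosetProj s u a q) := by
  have hp (y : B) : cosetProj s u a q * (u (-i) * y) =
      cosetProj s u a q * (u (-i) * (cosetProj s u c N * y)) := by
    rw [← mul_assoc (u (-i)), h.u_mul_cosetProj, ← mul_assoc, ← mul_assoc, ← mul_assoc,
      h.cosetProj_mul_cosetProj_of_dvd hq ha]
  rw [hp, hz, mul_smul_comm, mul_smul_comm, ← hp, h.u_mul_u, smul_mul_assoc]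

variable [IsDomain R] [∀ m : R⁰, Finite (R ⧸ Ideal.span {(m : R)})]

theorem star_mul_mul_mul_mem_negligible (hR : ¬ IsField R) (h : Relations Eq s u) {x w b : B}
    (hx : x ∈ h.homog 0) (hw : w ∈ ⨆ (g) (_ : g ≠ 0), h.homog g) (hb : b ∈ h.homog 0) :
    star (x * b) * (w * b) ∈ h.negligible := by
  have hgrading := h.isStarGrading_homog
  have hle : (⨆ (g) (_ : g ≠ 0), h.homog g) ≤ h.negligible :=
    iSup₂_le fun _ hg => h.homog_le_negligible hR hg
  have hxb : star (x * b) ∈ h.homog 0 := hgrading.star_mem_zero (hgrading.mul_mem_zero hx hb)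
  exact hle (hgrading.mul_mem_iSup_ne_zero hxb (hgrading.iSup_ne_zero_mul_mem hb hw))

theorem exists_forall_cosetProj_mul_u_mul_cosetProj_eq_zero (hR : ¬ IsField R)
    (h : Relations Eq s u) {x w : B} (hx : x ∈ h.homog 0)
    (hw : w ∈ ⨆ (g) (_ : g ≠ 0), h.homog g) (F : Finset R) (i : R) (k : ℕ) (c : R) (N : R⁰) :
    ∃ (a : R) (q : R⁰), (N : R) ∣ a - c ∧ N ∣ q ∧
      (∀ j ∈ F, j ≠ i → cosetProj s u a q * u (-i + j) * cosetProj s u a q = 0) ∧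
      ∀ b ∈ (fun j => (star x * x) ^ j) '' Set.Iio k,
        cosetProj s u a q * (star (x * b) * (w * b)) * cosetProj s u a q = 0 ∧
        cosetProj s u a q * (star (star x * (x * b)) * (star w * (x * b))) *
          cosetProj s u a q = 0 := by
  have hgrading := h.isStarGrading_homog
  have hx' : star x ∈ h.homog 0 := hgrading.star_mem_zero hx
  set powers := (fun j => (star x * x) ^ j) '' Set.Iio k
  have hb : ∀ b ∈ powers, b ∈ h.homog 0 := by
    rintro _ ⟨j, -, rfl⟩
    exact hgrading.pow_mem_zero (hgrading.mul_mem_zero hx' hx) j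
  let T := (fun j => u (-i + j)) '' {j ∈ (F : Set R) | j ≠ i} ∪
    ((fun b => star (x * b) * (w * b)) '' powers ∪
      (fun b => star (star x * (x * b)) * (star w * (x * b))) '' powers)
  have hT : T.Finite := ((F.finite_toSet.subset (Set.sep_subset _ _)).image _).union
    ((((Set.finite_Iio k).image _).image _).union (((Set.finite_Iio k).image _).image _))
  have hTn : T ⊆ h.negligible := by
    rintro _ (⟨j, ⟨-, hji⟩, rfl⟩ | ⟨b, hbp, rfl⟩ | ⟨b, hbp, rfl⟩)
    · exact h.u_mem_negligible hR (by rwa [Ne, neg_add_eq_zero, eq_comm])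
    · exact h.star_mul_mul_mul_mem_negligible hR hx hw (hb b hbp)
    · exact h.star_mul_mul_mul_mem_negligible hR hx' (hgrading.star_mem_iSup_ne_zero hw)
        (hgrading.mul_mem_zero hx (hb b hbp))
  obtain ⟨a, q, ha, hq, hzero⟩ :=
    h.exists_forall_cosetProj_mul_mul_cosetProj_eq_zero hT hTn c N
  exact ⟨a, q, ha, hq, fun j hj hji => hzero _ (.inl ⟨j, ⟨hj, hji⟩, rfl⟩), fun b hb =>
    ⟨hzero _ (.inr (.inl ⟨b, hb, rfl⟩)), hzero _ (.inr (.inr ⟨b, hb, rfl⟩))⟩⟩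

theorem norm_map_pow_mul_le (π : B →⋆ₐ[ℂ] A) {x w v : B} {k : ℕ}
    (hv : ∀ b ∈ (fun j => (star x * x) ^ j) '' Set.Iio k,
      star v * (star (x * b) * (w * b)) * v = 0 ∧
      star v * (star (star x * (x * b)) * (star w * (x * b))) * v = 0) :
    ‖π ((star x * x) ^ k * v)‖ ≤ ‖π (x + w)‖ ^ (2 * k) * ‖π v‖ := by
  simp only [map_mul, map_pow, map_star, map_add]
  refine norm_pow_mul_le_of_star_mul_eq_zero (fun j hj => ?_) fun j hj => ?_
  · simpa [map_star, mul_assoc] using congrArg π (hv _ ⟨j, hj, rfl⟩).1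
  · simpa [map_star, mul_assoc] using congrArg π (hv _ ⟨j, hj, rfl⟩).2

theorem norm_cosetProj_mul_le [Nontrivial A] (hR : ¬ IsField R) (h : Relations Eq s u)
    (π : B →⋆ₐ[ℂ] A) {x w : B} (hx : x ∈ h.homog 0) (hw : w ∈ ⨆ (g) (_ : g ≠ 0), h.homog g)
    {N : R⁰} {k : ℕ} {F : Finset R} {z : R → B} (hz : ∀ i, z i ∈ coreGrade s u N i)
    (hpow : (star x * x) ^ k = ∑ i ∈ F, z i) {i : R} (hi : i ∈ F) (c : R) :
    ‖cosetProj s u c N * z i‖ ≤ ‖π (x + w)‖ ^ (2 * k) := by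
  choose l hl using fun j => h.exists_cosetProj_mul_eq_smul (hz j) c
  obtain ⟨a, q, ha, hq, hF, hcross⟩ :=
    h.exists_forall_cosetProj_mul_u_mul_cosetProj_eq_zero hR hx hw F i k (-i + c) N
  set p := cosetProj s u a q
  have hscalar : p * (u (-i) * (star x * x) ^ k) * p = l i • p :=
    calc p * (u (-i) * (star x * x) ^ k) * p = ∑ j ∈ F, l j • (p * u (-i + j) * p) := by
          simp only [hpow, Finset.mul_sum, Finset.sum_mul]
          exact Finset.sum_congr rfl fun j _ =>
            h.cosetProj_mul_u_neg_mul_mul_cosetProj hq ha (hl j)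
      _ = l i • (p * u (-i + i) * p) := by
          refine Finset.sum_eq_single_of_mem i hi fun j hj hji => ?_
          rw [hF j hj hji, smul_zero]
      _ = l i • p := by rw [neg_add_cancel, h.u_zero, mul_one, h.cosetProj_mul_self]
  have hpnorm : ‖p‖ ≤ 1 := (h.isStarProjection_cosetProj a q).norm_le
  have hle : ‖π (p * u (-i))‖ ≤ 1 :=
    (NonUnitalStarAlgHom.norm_apply_le π _).trans <| (norm_mul_le _ _).trans <|
      mul_le_one₀ hpnorm (norm_nonneg _) (h.norm_u_le_one _)
  calc ‖cosetProj s u c N * z i‖ ≤ ‖l i‖ := by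
        rw [hl, norm_smul]
        exact mul_le_of_le_one_right (norm_nonneg _) <| (norm_mul_le _ _).trans <|
          mul_le_one₀ (h.isStarProjection_cosetProj c N).norm_le (norm_nonneg _)
            (h.norm_u_le_one i)
    _ ≤ ‖π (l i • p)‖ := by
        rw [map_smul, norm_smul]
        exact le_mul_of_one_le_right (norm_nonneg _) (h.one_le_norm_map_cosetProj π a q)
    _ = ‖π (p * u (-i)) * π ((star x * x) ^ k * p)‖ := by
        rw [← hscalar, ← map_mul]; simp only [mul_assoc]
    _ ≤ 1 * (‖π (x + w)‖ ^ (2 * k) * 1) := by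
        refine (norm_mul_le _ _).trans (mul_le_mul hle ?_ (norm_nonneg _) zero_le_one)
        refine (norm_map_pow_mul_le π (w := w) fun b hb => ?_).trans ?_
        · rw [h.star_cosetProj]; exact hcross b hb
        · gcongr
          exact (NonUnitalStarAlgHom.norm_apply_le π p).trans hpnorm
    _ = ‖π (x + w)‖ ^ (2 * k) := by rw [one_mul, mul_one]

theorem norm_le_norm_map_add [Nontrivial A] (hR : ¬ IsField R) (h : Relations Eq s u)
    (π : B →⋆ₐ[ℂ] A) {x w : B} (hx : x ∈ h.homog 0) (hw : w ∈ ⨆ (g) (_ : g ≠ 0), h.homog g) :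
    ‖x‖ ≤ ‖π (x + w)‖ := by
  have hxcore := h.mem_core_of_mem_homog_zero hx
  obtain ⟨N, hN⟩ := h.mem_core.1 (mul_mem (star_mem hxcore) hxcore)
  have := Fintype.ofFinite (R ⧸ Ideal.span {(N : R)})
  have := (h.isStarGrading_coreGrade N).toGradedMonoid
  refine norm_le_of_graded_pow_le (h.mem_coreLevel.1 hN) (Nat.cast_nonneg (Fintype.card
    (R ⧸ Ideal.span {(N : R)}))) (norm_nonneg _) fun k F z _ hz hpow i hi => ?_
  calc ‖z i‖ = ‖∑ c : R ⧸ Ideal.span {(N : R)}, cosetProj s u c.out N * z i‖ := by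
        rw [← Finset.sum_mul, h.sum_cosetProj, one_mul]
    _ ≤ ∑ _c : R ⧸ Ideal.span {(N : R)}, ‖π (x + w)‖ ^ (2 * k) :=
        norm_sum_le_of_le _ fun c _ => h.norm_cosetProj_mul_le hR π hx hw hz hpow hi c.out
    _ = Fintype.card (R ⧸ Ideal.span {(N : R)}) * ‖π (x + w)‖ ^ (2 * k) := by simp

end Relations

end Estimate

section Uniqueness

theorem exists_starAlgEquiv_of_range_eq {S B C A : Type*} [CommSemiring S] [StarRing S] [Semiring B]
    [StarRing B] [Algebra S B] [StarModule S B] [Semiring C] [StarRing C] [Algebra S C]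
    [StarModule S C] [Semiring A] [StarRing A] [Algebra S A] [StarModule S A] {π : B →⋆ₐ[S] A}
    {ι : C →⋆ₐ[S] A} (hπ : Function.Injective π) (hι : Function.Injective ι)
    (hrange : π.range = ι.range) : ∃ e : B ≃⋆ₐ[S] C, ∀ b, ι (e b) = π b := by
  have hmem : ∀ b, π b ∈ ι.range := fun b => hrange ▸ ⟨b, rfl⟩
  have hbij : Function.Bijective (π.codRestrict ι.range hmem) := by
    refine ⟨(StarAlgHom.injective_codRestrict _ _ _).2 hπ, fun ⟨a, ha⟩ => ?_⟩
    obtain ⟨b, rfl⟩ : a ∈ π.range := hrange ▸ ha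
    exact ⟨b, rfl⟩
  refine ⟨(StarAlgEquiv.ofBijective _ hbij).trans (StarAlgEquiv.ofInjective ι hι).symm,
    fun b => ?_⟩
  exact congrArg Subtype.val ((StarAlgEquiv.ofInjective ι hι).apply_symm_apply _)

variable {R : Type*} [CommRing R] {A : Type*} [CStarAlgebra A]

namespace Relations

variable [IsDomain R] [∀ m : R⁰, Finite (R ⧸ Ideal.span {(m : R)})] {B : Type*}
  [CStarAlgebra B] {s : R⁰ → B} {u : R → B}

theorem adjoin_le_starSubalgebra_homog (h : Relations Eq s u) :
    StarAlgebra.adjoin ℂ (Set.range s ∪ Set.range u) ≤ h.isStarGrading_homog.starSubalgebra := by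
  refine StarAlgebra.adjoin_le ?_
  rintro _ (⟨m, rfl⟩ | ⟨n, rfl⟩)
  · exact Submodule.mem_iSup_of_mem _ (h.s_mem_homog m)
  · exact Submodule.mem_iSup_of_mem 0 (h.mem_homog_zero_of_mem_core (h.u_mem_core n))

theorem isometry_of_topologicalClosure_adjoin_eq_top [Nontrivial A] (hR : ¬ IsField R)
    (h : Relations Eq s u)
    (hdense : (StarAlgebra.adjoin ℂ (Set.range s ∪ Set.range u)).topologicalClosure = ⊤)
    (π : B →⋆ₐ[ℂ] A) : Isometry π := by
  have hcont : Continuous π := AddMonoidHomClass.continuous_of_bound π 1 fun x => by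
    simpa only [one_mul] using NonUnitalStarAlgHom.norm_apply_le π x
  have hclosed : IsClosed {b | ‖b‖ ≤ ‖π b‖} := isClosed_le continuous_norm hcont.norm
  refine AddMonoidHomClass.isometry_of_norm π fun b =>
    (NonUnitalStarAlgHom.norm_apply_le π b).antisymm ?_
  have hb : b ∈ (StarAlgebra.adjoin ℂ (Set.range s ∪ Set.range u)).topologicalClosure :=
    hdense ▸ StarSubalgebra.mem_top
  exact closure_minimal (fun y hy => h.isStarGrading_homog.norm_le_norm_map π
    (fun x hx w hw => h.norm_le_norm_map_add hR π hx hw) (h.adjoin_le_starSubalgebra_homog hy))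
    hclosed hb

end Relations

namespace UnivAlg

theorem coe_mem {S : StarSubalgebra ℂ (UnivAlg R)} (hs : ∀ m, s m ∈ S)
    (hu : ∀ n, u n ∈ S) (x : FreeStarAlg R) : coe R x ∈ S := by
  have hgen : ∀ y : R⁰ ⊕ R, coe R (FreeStarAlg.letter (Sum.inl y)) ∈ S := Sum.rec hs hu
  induction x using FreeStarAlg.induction with
  | algebraMap c =>
    rw [Algebra.algebraMap_eq_smul_one, coe_smul, map_one]
    exact S.smul_mem (one_mem S) c
  | letter x =>
    rcases x with y | y
    · exact hgen y
    · have hstar : FreeStarAlg.letter (Sum.inr y) = star (FreeStarAlg.letter (Sum.inl y)) := by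
        rw [FreeStarAlg.star_letter, Sum.swap_inl]
      rw [hstar, ← star_coe]
      exact star_mem (hgen y)
  | mul a b ha hb => rw [map_mul]; exact mul_mem ha hb
  | add a b ha hb => rw [map_add]; exact add_mem ha hb

variable (R) in
theorem topologicalClosure_adjoin_eq_top :
    (StarAlgebra.adjoin ℂ (Set.range (s (R := R)) ∪ Set.range u)).topologicalClosure = ⊤ := by
  refine StarSubalgebra.eq_top_iff.2 fun a => ?_
  induction a using induction_on with
  | hp =>
    exact (StarAlgebra.adjoin ℂ (Set.range (s (R := R)) ∪ Set.range u)).isClosed_topologicalClosure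
  | ih x =>
    exact StarSubalgebra.le_topologicalClosure _ <|
      coe_mem (fun m => StarAlgebra.subset_adjoin ℂ _ (.inl ⟨m, rfl⟩))
        (fun n => StarAlgebra.subset_adjoin ℂ _ (.inr ⟨n, rfl⟩)) x

theorem range_eq_topologicalClosure_adjoin {π : UnivAlg R →⋆ₐ[ℂ] A}
    (hπ : Isometry π) : π.range = (StarAlgebra.adjoin ℂ
      ((Set.range fun m => π (s m)) ∪ Set.range fun n => π (u n))).topologicalClosure := by
  rw [StarAlgHom.range_eq_map_top, ← topologicalClosure_adjoin_eq_top,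
    ← StarSubalgebra.topologicalClosure_map _ π hπ.isClosedEmbedding.isClosedMap hπ.continuous,
    StarAlgHom.map_adjoin, Set.image_union, ← Set.range_comp, ← Set.range_comp]
  rfl

/-- Stated for an embedded copy `C` of the generated C*-algebra, in order to apply both to an
algebra that is generated by `s'` and `u'` and to a concrete algebra of operators. -/
theorem existsUnique_starAlgEquiv [IsDomain R] [∀ m : R⁰, Finite (R ⧸ Ideal.span {(m : R)})]
    [Nontrivial A] (hR : ¬ IsField R) {s' : R⁰ → A} {u' : R → A} (h : Relations Eq s' u')
    {C : Type*} [Semiring C] [StarRing C] [Algebra ℂ C] [StarModule ℂ C] {ι : C →⋆ₐ[ℂ] A}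
    (hι : Function.Injective ι)
    (hrange : ι.range = (StarAlgebra.adjoin ℂ (Set.range s' ∪ Set.range u')).topologicalClosure) :
    ∃! φ : UnivAlg R ≃⋆ₐ[ℂ] C, (∀ m, ι (φ (s m)) = s' m) ∧ ∀ n, ι (φ (u n)) = u' n := by
  obtain ⟨π, ⟨hs, hu⟩, hunique⟩ := existsUnique_lift h
  have hπ : Isometry π := relations.isometry_of_topologicalClosure_adjoin_eq_top hR
    (topologicalClosure_adjoin_eq_top R) π
  have hπrange : π.range = ι.range := by
    rw [range_eq_topologicalClosure_adjoin hπ, hrange, funext hs, funext hu]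
  obtain ⟨φ, hφ⟩ := exists_starAlgEquiv_of_range_eq hπ.injective hι hπrange
  refine ⟨φ, ⟨fun m => (hφ _).trans (hs m), fun n => (hφ _).trans (hu n)⟩, ?_⟩
  rintro ψ ⟨hψs, hψu⟩
  have hψ : ι.comp (ψ : UnivAlg R →⋆ₐ[ℂ] C) = π := hunique _ ⟨hψs, hψu⟩
  exact StarAlgEquiv.ext fun a => hι ((DFunLike.congr_fun hψ a).trans (hφ a).symm)

end UnivAlg

end Uniqueness

section RegularRepresentation

theorem ext_xi {X : Type*} {F : Type*} [AddCommMonoid F] [Module ℂ F] [TopologicalSpace F]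
    [T2Space F] {T T' : Ell2 X →L[ℂ] F} (h : ∀ r, T (xi r) = T' (xi r)) : T = T' := by
  classical
  refine lp.ext_continuousLinearMap ENNReal.ofNat_ne_top fun i => ContinuousLinearMap.ext_ring ?_
  exact h i

theorem eq_zero_of_inner_xi {X : Type*} {x : Ell2 X} (h : ∀ r, inner ℂ (xi r) x = 0) : x = 0 := by
  classical
  ext r
  simpa [xi, lp.inner_single_left] using h r

instance {X : Type*} [Nonempty X] : Nontrivial (Ell2 X) :=
  ⟨_, _, orthonormal_xi.ne_zero (Classical.arbitrary X)⟩

variable {R : Type*} [CommRing R]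

theorem star_regS_mul_self (m : R⁰) : star (regS m) * regS m = 1 :=
  LinearIsometry.adjoint_comp_self _

theorem star_regU_mul_self (n : R) : star (regU n) * regU n = 1 :=
  LinearIsometry.adjoint_comp_self _

theorem regU_mul_regU (l n : R) : regU l * regU n = regU (l + n) :=
  ext_xi fun r => by simp only [mul_apply_eq_comp, regU_xi, add_assoc]

theorem regU_zero : regU (0 : R) = 1 :=
  ext_xi fun r => by rw [regU_xi, zero_add, one_apply_eq_self]

theorem regU_mul_star_self (n : R) : regU n * star (regU n) = 1 := by
  have hinv : regU n * regU (-n) = 1 := by rw [regU_mul_regU, add_neg_cancel, regU_zero]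
  have hstar : star (regU n) = regU (-n) := left_inv_eq_right_inv (star_regU_mul_self n) hinv
  rw [hstar, hinv]

open Classical in
theorem regS_mul_star_self_xi (m : R⁰) (r : R) :
    (regS m * star (regS m)) (xi r) = if (m : R) ∣ r then xi r else 0 := by
  split_ifs with hr
  · obtain ⟨t, rfl⟩ := hr
    rw [← regS_xi, ← mul_apply_eq_comp, mul_assoc, star_regS_mul_self, mul_one]
  · have hker : star (regS m) (xi r) = 0 := eq_zero_of_inner_xi fun j => by
      rw [ContinuousLinearMap.star_eq_adjoint, ContinuousLinearMap.adjoint_inner_right, regS_xi]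
      exact orthonormal_xi.2 fun hj => hr ⟨j, hj.symm⟩
    rw [mul_apply_eq_comp, hker, map_zero]

open Classical in
theorem regU_mul_regS_mul_star_self_mul_regU_neg_xi (m : R⁰) (n r : R) :
    (regU n * (regS m * star (regS m)) * regU (-n)) (xi r) =
      if (m : R) ∣ r - n then xi r else 0 := by
  rw [mul_apply_eq_comp, mul_apply_eq_comp, regU_xi, regS_mul_star_self_xi,
    neg_add_eq_sub, apply_ite (regU n), regU_xi, add_sub_cancel, map_zero]

theorem relations_reg [∀ m : R⁰, Finite (R ⧸ Ideal.span {(m : R)})] :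
    Relations Eq (regS (R := R)) regU where
  isometry := star_regS_mul_self
  unitary_left := star_regU_mul_self
  unitary_right := regU_mul_star_self
  s_mul_s k m := ext_xi fun r => by
    simp only [mul_apply_eq_comp, regS_xi, Submonoid.coe_mul, mul_assoc]
  u_mul_u := regU_mul_regU
  s_mul_u m n := ext_xi fun r => by
    simp only [mul_apply_eq_comp, regS_xi, regU_xi, mul_add]
  range_sum m := by
    classical
    have := Fintype.ofFinite (R ⧸ Ideal.span {(m : R)})
    have hmem (c : R ⧸ Ideal.span {(m : R)}) (r : R) :
        (m : R) ∣ r - c.out ↔ Ideal.Quotient.mk _ r = c := by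
      rw [← Ideal.mem_span_singleton, ← Ideal.Quotient.eq, Ideal.Quotient.mk_out]
    refine ext_xi fun r => ?_
    rw [finsum_eq_sum_of_fintype, sum_apply]
    simp only [regU_mul_regS_mul_star_self_mul_regU_neg_xi, hmem, Finset.sum_ite_eq,
      Finset.mem_univ, if_true, one_apply_eq_self]

end RegularRepresentation

end RingCStar

end

theorem mainTheorem3 {R : Type u} [CommRing R] [IsDomain R] (hfield : ¬ IsField R)
    (hfin : ∀ m : R, m ≠ 0 → Finite (R ⧸ Ideal.span {m})) :
    (∀ (A : Type v) [CStarAlgebra A] [Nontrivial A] (s : R⁰ → A) (u : R → A),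
      RingCStar.Relations Eq s u →
      (StarAlgebra.adjoin ℂ (Set.range s ∪ Set.range u)).topologicalClosure = ⊤ →
      ∃! φ : RingCStar.UnivAlg R ≃⋆ₐ[ℂ] A,
        (∀ m, φ (RingCStar.UnivAlg.s m) = s m) ∧ ∀ n, φ (RingCStar.UnivAlg.u n) = u n) ∧
    ∃! φ : RingCStar.UnivAlg R ≃⋆ₐ[ℂ] RingCStar.regAlg R,
      (∀ m, φ (RingCStar.UnivAlg.s m) = ⟨RingCStar.regS m, RingCStar.regS_mem m⟩) ∧
        ∀ n, φ (RingCStar.UnivAlg.u n) = ⟨RingCStar.regU n, RingCStar.regU_mem n⟩ := by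
  have _ : ∀ m : R⁰, Finite (R ⧸ Ideal.span {(m : R)}) :=
    fun m => hfin m (nonZeroDivisors.coe_ne_zero m)
  refine ⟨fun A _ _ s u h hgen => ?_, ?_⟩
  · have hrange : (StarAlgHom.id ℂ A).range =
        (StarAlgebra.adjoin ℂ (Set.range s ∪ Set.range u)).topologicalClosure := by
      rw [hgen, StarAlgHom.range_eq_map_top, StarSubalgebra.map_id]
    exact RingCStar.UnivAlg.existsUnique_starAlgEquiv hfield h Function.injective_id hrange
  · have hrange : (RingCStar.regAlg R).subtype.range = RingCStar.regAlg R :=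
      SetLike.coe_injective Subtype.range_coe
    simp only [Subtype.ext_iff]
    exact RingCStar.UnivAlg.existsUnique_starAlgEquiv hfield RingCStar.relations_reg
      Subtype.val_injective hrange
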